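/- **Definitions.** A degree-$t$ pseudo-distribution over $\mathbb R^d$ is a finitely supported function $\mu:\mathbb R^d\to\mathbb R$ with $\sum_x\mu(x)=1$ and $\tilde{\mathbb E}_\mu[p^2]\ge 0$ for every polynomial $p$ with $2\deg p\le t$, where $\tilde{\mathbb E}_\mu[f]=\sum_x\mu(x)f(x)$. It satisfies $\|v\|_2^2=1$ at degree $t$ if it satisfies the pair of constraints $g_1=\|v\|_2^2-1\ge 0$, $g_2=1-\|v\|_2^2\ge 0$, i.e. $\tilde{\mathbb E}_\mu[q\prod_{i\in T}g_i]\ge 0$ for all $T\subseteq\{1,2\}$ and all sums of squares $q$ with $\deg q+\sum_{i\in T}\deg g_i\le t$. A reweighting of $\mu$ of degree at most $s$ is $\mu'(x)=\mu(x)q(x)/\tilde{\mathbb E}_\mu[q]$ for a sum-of-squares polynomial $q$ of degree at most $s$ with $\tilde{\mathbb E}_\mu[q]>0$. We write $\|x\|_{2z}^{2z}=\sum_i x_i^{2z}$ and $[k]=\{1,\dots,k\}$. **Reweighting procedure.** Given $\mu$, $z,k,\delta,\eta$, set $\mu_0=\mu$, $u^{(0)}=0$. After $\ell$ rounds, stop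 if either $\tilde{\mathbb E}_{\mu_\ell}\|v-u^{(\ell)}\|_2^{2y}\le\eta$ for all $y\in[k]$, or $\tilde{\mathbb E}_{\mu_\ell}\|v-u^{(\ell)}\|_{2z}^{2z}\le(2\delta)^{2z}\,\tilde{\mathbb E}_{\mu_\ell}\|v-u^{(\ell)}\|_2^{2z}$. Otherwise choose a coordinate $i$ with $\tilde{\mathbb E}_{\mu_\ell}(v_i-u^{(\ell)}_i)^{2z}>\delta^{2z}\,\tilde{\mathbb E}_{\mu_\ell}\|v-u^{(\ell)}\|_2^{2z}$, choose a reweighting $\mu_{\ell+1}$ of $\mu_\ell$, and set $u^{(\ell+1)}=u^{(\ell)}+\tilde{\mathbb E}_{\mu_{\ell+1}}[v_i-u^{(\ell)}_i]\,e_i$. **Theorem.** There is an absolute constant $C>0$ such that the following holds. Let $k,d,z,t$ be nonnegative integers with $d\ge1$ and $z\ge\log d$, let $0<\delta<1$ and $0<\eta<1$, and let $t\ge C\,z/(\eta^2\delta^{4k+2})$. Let $\mu$ be a degree-$t$ pseudo-distribution over $v\in\mathbb R^d$ satisfying $\|v\|_2^2=1$ at degree $t$. Then the choices in the reweighting procedure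 can be made so that, after at most $C/(\delta^{4k+2}\eta^2)$ rounds and with reweighting polynomials of total degree at most some $s\le t/2$, it reaches a pair $(\mu',u_{\mathcal S})$ such that $\mu'$ is a reweighting of $\mu$ of degree at most $s$, is a degree-$(t-s)$ pseudo-distribution satisfying $\|v\|_2^2=1$ at degree $t-s$, the vector $u_{\mathcal S}$ is supported on a set $\mathcal S\subseteq[d]$ with $|\mathcal S|\le C/(\delta^{4k+2}\eta^2)$, and one of the following holds: 1. (hypercontractivity at non-trivial scale) $\tilde{\mathbb E}_{\mu'}\|v-u_{\mathcal S}\|_{2z}^{2z}\le(2\delta)^{2z}\,\tilde{\mathbb E}_{\mu'}\|v-u_{\mathcal S}\|_2^{2z}$ and $\tilde{\mathbb E}_{\mu'}\|v-u_{\mathcal S}\|_2^{2y}>\eta$ for some $y\in[k]$; 2. (bounded pseudo-moments of the norm) $\tilde{\mathbb E}_{\mu'}\|v-u_{\mathcal S}\|_2^{2y}\le\eta$ for all $y\in[k]$. -/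

import Mathlib

/-- The ambient space `ℝ^d` with its Euclidean norm. -/
abbrev Vec (d : ℕ) : Type := EuclideanSpace ℝ (Fin d)

/-- The function on `ℝ^d` given by a polynomial in `d` indeterminates. -/
noncomputable def polyFun {d : ℕ} (p : MvPolynomial (Fin d) ℝ) (x : Vec d) : ℝ :=
  MvPolynomial.eval (fun i => x i) p

/-- The pseudo-expectation `∑ x, μ x * f x` of a function `f` with respect to a finitely
supported signed mass function `μ`. -/
noncomputable def pExp {d : ℕ} (μ : Vec d →₀ ℝ) (f : Vec d → ℝ) : ℝ :=
  μ.sum fun x a => a * f x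

/-- Degree-`t` pseudo-distributions over `ℝ^d`: finitely supported real functions of total mass
one under which squares of polynomials of degree at most `t / 2` have nonnegative
pseudo-expectation. -/
structure IsPseudoDist {d : ℕ} (t : ℕ) (μ : Vec d →₀ ℝ) : Prop where
  total_mass : pExp μ (fun _ => 1) = 1
  sq_nonneg : ∀ p : MvPolynomial (Fin d) ℝ, 2 * p.totalDegree ≤ t →
    0 ≤ pExp μ (fun x => polyFun p x ^ 2)

/-- `μ` satisfies the system of polynomial constraints `A i ≥ 0` at degree `t`. -/
def Satisfies {d m : ℕ} (t : ℕ) (μ : Vec d →₀ ℝ) (A : Fin m → MvPolynomial (Fin d) ℝ) : Prop :=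
  ∀ (S : Finset (Fin m)) (q : MvPolynomial (Fin d) ℝ), IsSumSq q →
    q.totalDegree + ∑ i ∈ S, (A i).totalDegree ≤ t →
    0 ≤ pExp μ (polyFun (q * ∏ i ∈ S, A i))

/-- The polynomial `‖v‖² - 1`. -/
noncomputable def spherePoly (d : ℕ) : MvPolynomial (Fin d) ℝ :=
  (∑ i, MvPolynomial.X i ^ 2) - 1

/-- The equality constraint `‖v‖² = 1`, as the pair of constraints `‖v‖² - 1 ≥ 0` and
`-(‖v‖² - 1) ≥ 0`. -/
noncomputable def sphereConstraint (d : ℕ) : Fin 2 → MvPolynomial (Fin d) ℝ :=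
  ![spherePoly d, -spherePoly d]

/-- `μ'` is the (normalized) reweighting of `μ` by some sum-of-squares polynomial of degree at
most `s` that has positive pseudo-expectation. -/
def IsReweighting {d : ℕ} (s : ℕ) (μ μ' : Vec d →₀ ℝ) : Prop :=
  ∃ q : MvPolynomial (Fin d) ℝ, IsSumSq q ∧ q.totalDegree ≤ s ∧ 0 < pExp μ (polyFun q) ∧
    ∀ x, μ' x = μ x * polyFun q x / pExp μ (polyFun q)

/-- The pseudo-moment of `‖v - u‖₂ ^ (2 * y)`. -/
noncomputable def normMoment {d : ℕ} (μ : Vec d →₀ ℝ) (u : Vec d) (y : ℕ) : ℝ :=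
  pExp μ (fun v => ‖v - u‖ ^ (2 * y))

/-- Analytic density (hypercontractivity) of `v - u`: the pseudo-moment of the `2z`-th power of
the `ℓ_{2z}` norm is at most `(2δ)^(2z)` times that of the `2z`-th power of the `ℓ_2` norm. -/
def AnalyticallyDense {d : ℕ} (z : ℕ) (δ : ℝ) (μ : Vec d →₀ ℝ) (u : Vec d) : Prop :=
  pExp μ (fun v => ∑ i, (v i - u i) ^ (2 * z)) ≤ (2 * δ) ^ (2 * z) * normMoment μ u z

/-- All pseudo-moments of `‖v - u‖₂ ^ (2 * y)` with `1 ≤ y ≤ k` are at most `η`. -/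
def SmallMoments {d : ℕ} (k : ℕ) (η : ℝ) (μ : Vec d →₀ ℝ) (u : Vec d) : Prop :=
  ∀ y ∈ Finset.Icc 1 k, normMoment μ u y ≤ η

/-- `ReweightRun z k δ η μ₀ n s μ u`: starting from `μ₀` and `u = 0`, the iterative reweighting
procedure can reach the pair `(μ, u)` after `n` rounds, having reweighted by polynomials of total
degree at most `s`. A round is made only if neither stopping criterion holds; it selects a
coordinate `i` of `v - u` whose `2z`-th pseudo-moment is large, reweights, and then adds the new
pseudo-expectation of `(v - u) i` to the `i`-th coordinate of `u`. -/
inductive ReweightRun {d : ℕ} (z k : ℕ) (δ η : ℝ) (μ₀ : Vec d →₀ ℝ) :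
    ℕ → ℕ → (Vec d →₀ ℝ) → Vec d → Prop
  | init : ReweightRun z k δ η μ₀ 0 0 μ₀ 0
  | round {n s s' : ℕ} {μ μ' : Vec d →₀ ℝ} {u : Vec d} (i : Fin d)
      (prev : ReweightRun z k δ η μ₀ n s μ u)
      (not_small : ¬ SmallMoments k η μ u)
      (not_dense : ¬ AnalyticallyDense z δ μ u)
      (large : δ ^ (2 * z) * normMoment μ u z < pExp μ (fun v => (v i - u i) ^ (2 * z)))
      (rew : IsReweighting s' μ μ') :
      ReweightRun z k δ η μ₀ (n + 1) (s + s') μ'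
        (u + EuclideanSpace.single i (pExp μ' (fun v => v i - u i)))

/-!
The proof tracks the squared distance `s = ‖v - u‖²`, which is `1` on the sphere when `u = 0`.
If coordinate `i` is selected and its centre moves from `u i` to `a`, then `s` drops by
`(v i - u i)² - (v i - a)²`, an affine function of `v i`. The round reweights by `y ^ (16 M)`, where
`y = 1 + ((v i - u i)² - (v i - a)²) / 16` is the `tiltPoly` of the move and `M` is of order
`z / τ` with `τ = η δ ^ (2k)`. The centre `a` is taken to maximize the pseudo-moment of
`y ^ (16 M + 1)`; stationarity says exactly that `a` is the mean of `v i` after the reweighting, so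
it is the centre which the procedure prescribes (`exists_maximal_tilt`).

*Gain.* If the stopping criteria fail, some coordinate has `2z`-th pseudo-moment at least `τ ^ z`
(`exists_large_coord`, `moment_lower_bound`). Expanding `y ^ (16 M + 1)` at the two centres
`u i ± √(z / M)` and keeping one even term shows that the maximum is at least `5/4 * exp z`, and then
`y ^ (16 M)` has pseudo-expectation at least `exp z` (`exists_tilt`). Hence after `r` rounds the
product `Q` of the reweighting polynomials has pseudo-expectation at least `exp (z r)` under `μ`.

*Bound.* The tilts `y` of the `r` rounds sum to `r + (‖v‖² - s) / 16`. So the factors of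
`Q * (κ + s) ^ M`, with `16 M r` tilts and `M` copies of `κ + s`, have a constant arithmetic mean on
the sphere, and the arithmetic-geometric mean inequality bounds the pseudo-expectation
(`pExpLin_prod_mul_le`). With `κ = 1` this gives `exp (z r) ≤ exp M`, so there are at most `M / z`
rounds. With `κ = 0` it says that the `M`-th pseudo-moment of `s` stays at most `1`; by
log-convexity of the pseudo-moments this is what allows a lower bound on the `z`-th one when the
moment exceeding `η` has order larger than `z`.

All inequalities between polynomials that are used under a pseudo-expectation have certificates of
bounded degree: they are membership statements in `SphereCone`, the cone of sums of squares modulo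
the ideal of the sphere. It is closed under products, and `SphereCone.amgm` is the
arithmetic-geometric mean inequality inside it.
-/

open MvPolynomial

/-! ### Linearity and positivity of pseudo-expectations -/

section Pseudoexpectation

variable {d : ℕ}

lemma pExp_eq_sum (μ : Vec d →₀ ℝ) (f : Vec d → ℝ) :
    pExp μ f = ∑ x ∈ μ.support, μ x * f x := rfl

lemma pExp_add (μ : Vec d →₀ ℝ) (f g : Vec d → ℝ) :
    pExp μ (fun x => f x + g x) = pExp μ f + pExp μ g := by
  simp only [pExp_eq_sum, mul_add, Finset.sum_add_distrib]

lemma pExp_const_mul (μ : Vec d →₀ ℝ) (a : ℝ) (f : Vec d → ℝ) :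
    pExp μ (fun x => a * f x) = a * pExp μ f := by
  simp only [pExp_eq_sum, Finset.mul_sum]
  exact Finset.sum_congr rfl fun x _ => by ring

/-- The pseudo-expectation as a linear functional on polynomials. -/
noncomputable def pExpLin (μ : Vec d →₀ ℝ) : MvPolynomial (Fin d) ℝ →ₗ[ℝ] ℝ where
  toFun p := pExp μ (polyFun p)
  map_add' p q := by
    rw [← pExp_add]; congr 1; funext x; simp [polyFun]
  map_smul' a p := by
    rw [RingHom.id_apply, smul_eq_mul, ← pExp_const_mul]
    congr 1; funext x; simp [polyFun]

lemma pExpLin_apply (μ : Vec d →₀ ℝ) (p : MvPolynomial (Fin d) ℝ) :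
    pExpLin μ p = pExp μ (polyFun p) := rfl

lemma pExpLin_eq_of_eval (μ : Vec d →₀ ℝ) {p : MvPolynomial (Fin d) ℝ} {f : Vec d → ℝ}
    (h : ∀ v, polyFun p v = f v) : pExp μ f = pExpLin μ p := by
  rw [pExpLin_apply]; congr 1; funext v; exact (h v).symm

lemma pExpLin_C_mul (μ : Vec d →₀ ℝ) (a : ℝ) (p : MvPolynomial (Fin d) ℝ) :
    pExpLin μ (C a * p) = a * pExpLin μ p := by
  rw [← smul_eq_C_mul, map_smul, smul_eq_mul]

lemma IsPseudoDist.pExpLin_one {t : ℕ} {μ : Vec d →₀ ℝ} (h : IsPseudoDist t μ) :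
    pExpLin μ 1 = 1 := by
  rw [← h.total_mass]; exact (pExpLin_eq_of_eval μ fun v => by simp [polyFun]).symm

lemma IsPseudoDist.pExpLin_C {t : ℕ} {μ : Vec d →₀ ℝ} (h : IsPseudoDist t μ) (a : ℝ) :
    pExpLin μ (C a) = a := by
  rw [← mul_one (C a), pExpLin_C_mul, h.pExpLin_one, mul_one]

lemma Satisfies.pExpLin_nonneg {t m : ℕ} {μ : Vec d →₀ ℝ}
    {A : Fin m → MvPolynomial (Fin d) ℝ} (h : Satisfies t μ A)
    {q : MvPolynomial (Fin d) ℝ} (hq : IsSumSq q) (hdeg : q.totalDegree ≤ t) :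
    0 ≤ pExpLin μ q := by
  simpa [pExpLin_apply] using h ∅ q hq (by simpa using hdeg)

/-! ### Reweighting -/

/-- The normalized reweighting of `μ` by the polynomial `q`. It is meaningful when `q` has nonzero
pseudo-expectation, and `0` otherwise. -/
noncomputable def reweight (μ : Vec d →₀ ℝ) (q : MvPolynomial (Fin d) ℝ) : Vec d →₀ ℝ :=
  Finsupp.onFinset μ.support (fun x => μ x * polyFun q x / pExp μ (polyFun q)) fun x hx => by
    rw [Finsupp.mem_support_iff]
    rintro h
    simp [h] at hx

lemma reweight_apply (μ : Vec d →₀ ℝ) (q : MvPolynomial (Fin d) ℝ) (x : Vec d) :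
    reweight μ q x = μ x * polyFun q x / pExp μ (polyFun q) := rfl

lemma pExp_reweight (μ : Vec d →₀ ℝ) (q : MvPolynomial (Fin d) ℝ) (f : Vec d → ℝ) :
    pExp (reweight μ q) f = pExp μ (fun x => polyFun q x * f x) / pExpLin μ q := by
  have hsub : (reweight μ q).support ⊆ μ.support := Finsupp.support_onFinset_subset
  rw [pExp_eq_sum, pExp_eq_sum, Finset.sum_div, Finset.sum_subset hsub]
  · refine Finset.sum_congr rfl fun x _ => ?_
    rw [reweight_apply, pExpLin_apply]; ring
  · intro x _ hx
    rw [Finsupp.notMem_support_iff.1 hx, zero_mul]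

lemma pExpLin_reweight (μ : Vec d →₀ ℝ) (q p : MvPolynomial (Fin d) ℝ) :
    pExpLin (reweight μ q) p = pExpLin μ (q * p) / pExpLin μ q := by
  rw [pExpLin_apply, pExp_reweight]
  congr 1
  exact pExpLin_eq_of_eval μ fun v => by simp [polyFun]

lemma reweight_one {t : ℕ} {μ : Vec d →₀ ℝ} (h : IsPseudoDist t μ) : reweight μ 1 = μ := by
  ext x
  rw [reweight_apply, ← pExpLin_apply, h.pExpLin_one]
  simp [polyFun]

lemma reweight_reweight (μ : Vec d →₀ ℝ) {q p : MvPolynomial (Fin d) ℝ}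
    (hq : pExpLin μ q ≠ 0) : reweight (reweight μ q) p = reweight μ (q * p) := by
  ext x
  rw [reweight_apply, reweight_apply, reweight_apply, ← pExpLin_apply, ← pExpLin_apply,
    ← pExpLin_apply, pExpLin_reweight]
  have : polyFun (q * p) x = polyFun q x * polyFun p x := by simp [polyFun]
  rw [this]
  by_cases h : pExpLin μ (q * p) = 0
  · simp [h]
  · field_simp

lemma isReweighting_reweight {s : ℕ} {μ : Vec d →₀ ℝ} {q : MvPolynomial (Fin d) ℝ}
    (hq : IsSumSq q) (hs : q.totalDegree ≤ s) (hpos : 0 < pExpLin μ q) :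
    IsReweighting s μ (reweight μ q) :=
  ⟨q, hq, hs, hpos, fun _ => rfl⟩

lemma Satisfies.reweight {s t m : ℕ} {μ : Vec d →₀ ℝ} {A : Fin m → MvPolynomial (Fin d) ℝ}
    (h : Satisfies t μ A) {q : MvPolynomial (Fin d) ℝ}
    (hq : IsSumSq q) (hs : q.totalDegree ≤ s) (hst : s ≤ t) (hpos : 0 < pExpLin μ q) :
    Satisfies (t - s) (reweight μ q) A := by
  intro S p hp hdeg
  rw [← pExpLin_apply, pExpLin_reweight, ← mul_assoc]
  refine div_nonneg (h S (q * p) (hq.mul hp) ?_) hpos.le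
  have := totalDegree_mul q p
  omega

lemma IsPseudoDist.reweight {s t m : ℕ} {μ : Vec d →₀ ℝ}
    {A : Fin m → MvPolynomial (Fin d) ℝ} (hA : Satisfies t μ A)
    {q : MvPolynomial (Fin d) ℝ}
    (hq : IsSumSq q) (hs : q.totalDegree ≤ s) (hst : s ≤ t) (hpos : 0 < pExpLin μ q) :
    IsPseudoDist (t - s) (reweight μ q) where
  total_mass := by
    rw [pExp_reweight]
    simp only [mul_one]
    rw [div_eq_one_iff_eq hpos.ne', pExpLin_apply]
  sq_nonneg p hp := by
    have := (hA.reweight hq hs hst hpos).pExpLin_nonneg (IsSumSq.mul_self p)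
      ((totalDegree_mul p p).trans (by omega))
    rwa [← pExpLin_eq_of_eval (f := fun x => polyFun p x ^ 2)] at this
    intro v; simp [polyFun, sq]

end Pseudoexpectation

/-! ### The cone of certified nonnegative polynomials on the sphere -/

section Cone

variable {d : ℕ}

/-- `SphereCone D p` says that `p` is, modulo the ideal of the unit sphere, a sum of squares, with
a certificate `p = q + r * (‖v‖² - 1)` both of whose summands have degree at most `D`. -/
def SphereCone (D : ℕ) (p : MvPolynomial (Fin d) ℝ) : Prop :=
  ∃ q r : MvPolynomial (Fin d) ℝ, IsSumSq q ∧ q.totalDegree ≤ D ∧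
    (r * spherePoly d).totalDegree ≤ D ∧ p = q + r * spherePoly d

lemma spherePoly_ne_zero (d : ℕ) : spherePoly d ≠ 0 := by
  intro h
  have := congrArg (MvPolynomial.eval (fun _ => (0 : ℝ))) h
  simp [spherePoly] at this

lemma totalDegree_spherePoly_le (d : ℕ) : (spherePoly d).totalDegree ≤ 2 := by
  refine (totalDegree_sub _ _).trans (max_le ?_ (by simp))
  refine (totalDegree_finsetSum _ _).trans (Finset.sup_le fun i _ => ?_)
  exact (totalDegree_pow _ _).trans (by simp)

lemma isSumSq_C {a : ℝ} (ha : 0 ≤ a) : IsSumSq (C a : MvPolynomial (Fin d) ℝ) := by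
  rw [← Real.mul_self_sqrt ha, C_mul]
  exact IsSumSq.mul_self _

lemma isSumSq_pow {q : MvPolynomial (Fin d) ℝ} (hq : IsSumSq q) (n : ℕ) : IsSumSq (q ^ n) := by
  induction n with
  | zero => rw [pow_zero, ← mul_one (1 : MvPolynomial (Fin d) ℝ)]; exact IsSumSq.mul_self 1
  | succ n ih => rw [pow_succ]; exact ih.mul hq

namespace SphereCone

lemma totalDegree_le {D : ℕ} {p : MvPolynomial (Fin d) ℝ} (h : SphereCone D p) :
    p.totalDegree ≤ D := by
  obtain ⟨q, r, -, hq, hr, rfl⟩ := h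
  exact (totalDegree_add _ _).trans (max_le hq hr)

lemma mono {D D' : ℕ} {p : MvPolynomial (Fin d) ℝ} (h : SphereCone D p) (hD : D ≤ D') :
    SphereCone D' p := by
  obtain ⟨q, r, hs, hq, hr, rfl⟩ := h
  exact ⟨q, r, hs, hq.trans hD, hr.trans hD, rfl⟩

lemma of_isSumSq {D : ℕ} {q : MvPolynomial (Fin d) ℝ} (hq : IsSumSq q)
    (hD : q.totalDegree ≤ D) : SphereCone D q :=
  ⟨q, 0, hq, hD, by simp, by simp⟩

lemma of_mul_spherePoly {D : ℕ} (r : MvPolynomial (Fin d) ℝ)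
    (hD : (r * spherePoly d).totalDegree ≤ D) : SphereCone D (r * spherePoly d) :=
  ⟨0, r, IsSumSq.zero, by simp, hD, by simp⟩

lemma C_nonneg {a : ℝ} (ha : 0 ≤ a) (D : ℕ) : SphereCone D (C a : MvPolynomial (Fin d) ℝ) :=
  of_isSumSq (isSumSq_C ha) (by simp)

lemma zero (D : ℕ) : SphereCone D (0 : MvPolynomial (Fin d) ℝ) :=
  of_isSumSq IsSumSq.zero (by simp)

lemma sq {D : ℕ} {p : MvPolynomial (Fin d) ℝ} (hD : p.totalDegree ≤ D) :
    SphereCone (2 * D) (p ^ 2) := by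
  refine of_isSumSq (by rw [_root_.sq]; exact IsSumSq.mul_self p) ?_
  exact (totalDegree_pow _ _).trans (by gcongr)

lemma add {D : ℕ} {p p' : MvPolynomial (Fin d) ℝ} (h : SphereCone D p) (h' : SphereCone D p') :
    SphereCone D (p + p') := by
  obtain ⟨q, r, hs, hq, hr, rfl⟩ := h
  obtain ⟨q', r', hs', hq', hr', rfl⟩ := h'
  refine ⟨q + q', r + r', hs.add hs', (totalDegree_add _ _).trans (max_le hq hq'), ?_, by ring⟩
  rw [add_mul]
  exact (totalDegree_add _ _).trans (max_le hr hr')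

lemma mul {D D' : ℕ} {p p' : MvPolynomial (Fin d) ℝ} (h : SphereCone D p)
    (h' : SphereCone D' p') : SphereCone (D + D') (p * p') := by
  obtain ⟨q, r, hs, hq, hr, rfl⟩ := h
  obtain ⟨q', r', hs', hq', hr', rfl⟩ := h'
  refine ⟨q * q', q * r' + q' * r + r * r' * spherePoly d, hs.mul hs',
    (totalDegree_mul _ _).trans (add_le_add hq hq'), ?_, by ring⟩
  have e : (q * r' + q' * r + r * r' * spherePoly d) * spherePoly d =
      q * (r' * spherePoly d) + q' * (r * spherePoly d) +
        (r * spherePoly d) * (r' * spherePoly d) := by ring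
  rw [e]
  refine (totalDegree_add _ _).trans (max_le ((totalDegree_add _ _).trans (max_le ?_ ?_)) ?_)
  · exact (totalDegree_mul _ _).trans (add_le_add hq hr')
  · exact (totalDegree_mul _ _).trans (by omega)
  · exact (totalDegree_mul _ _).trans (add_le_add hr hr')

lemma pow {D : ℕ} {p : MvPolynomial (Fin d) ℝ} (h : SphereCone D p) (n : ℕ) :
    SphereCone (D * n) (p ^ n) := by
  induction n with
  | zero => simpa using C_nonneg (d := d) zero_le_one 0
  | succ n ih => rw [pow_succ, mul_add, mul_one]; exact ih.mul h

lemma C_mul {D : ℕ} {p : MvPolynomial (Fin d) ℝ} (h : SphereCone D p) {a : ℝ} (ha : 0 ≤ a) :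
    SphereCone D (C a * p) := by
  simpa using (C_nonneg ha 0).mul h

/-- Certified polynomials have nonnegative pseudo-expectation. The degree requirement is twice
the natural one, since the multiplier of the ideal part is written as a difference of two
squares. -/
lemma pExpLin_nonneg {D t : ℕ} {p : MvPolynomial (Fin d) ℝ} (h : SphereCone D p)
    {μ : Vec d →₀ ℝ} (hμ : Satisfies t μ (sphereConstraint d)) (hD : 2 * D + 2 ≤ t) :
    0 ≤ pExpLin μ p := by
  obtain ⟨q, r, hs, hq, hr, rfl⟩ := h
  have hg := totalDegree_spherePoly_le d
  have key : ∀ p : MvPolynomial (Fin d) ℝ, p.totalDegree ≤ D →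
      pExpLin μ (p * p * spherePoly d) = 0 := by
    intro p hp
    have hpp := totalDegree_mul p p
    have h0 := hμ {0} (p * p) (IsSumSq.mul_self p) (by simp [sphereConstraint]; omega)
    have h1 := hμ {1} (p * p) (IsSumSq.mul_self p) (by simp [sphereConstraint]; omega)
    simp only [Finset.prod_singleton, sphereConstraint, Matrix.cons_val_zero,
      Matrix.cons_val_one, ← pExpLin_apply, mul_neg, map_neg] at h0 h1
    linarith
  have hrd : r.totalDegree ≤ D := by
    rcases eq_or_ne r 0 with rfl | h0
    · simp
    · rw [totalDegree_mul_of_isDomain h0 (spherePoly_ne_zero d)] at hr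
      omega
  have hd1 : (r + 1).totalDegree ≤ D := (totalDegree_add _ _).trans (max_le hrd (by simp))
  have hd2 : (r - 1).totalDegree ≤ D := (totalDegree_sub _ _).trans (max_le hrd (by simp))
  have e : C 4 * (r * spherePoly d) = (r + 1) * (r + 1) * spherePoly d -
      (r - 1) * (r - 1) * spherePoly d := by
    have : (C 4 : MvPolynomial (Fin d) ℝ) = 4 := map_ofNat C 4
    rw [this]; ring
  have e' := congrArg (pExpLin μ) e
  rw [pExpLin_C_mul, map_sub, key _ hd1, key _ hd2] at e'
  have := hμ.pExpLin_nonneg hs (by omega)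
  rw [map_add]
  linarith

/-- The quadratic remainder in Bernoulli's inequality is certified nonnegative. -/
lemma bernoulli {e : ℕ} {s l : MvPolynomial (Fin d) ℝ} (hs : SphereCone e s)
    (hl : SphereCone e l) (n : ℕ) :
    SphereCone (e * (n + 1)) (s ^ (n + 1) - C (n + 1 : ℝ) * s * l ^ n +
      C (n : ℝ) * l ^ (n + 1)) := by
  induction n with
  | zero => simpa using zero _
  | succ n ih =>
    have e1 : s ^ (n + 1 + 1) - C ((n + 1 : ℕ) + 1 : ℝ) * s * l ^ (n + 1) +
          C ((n + 1 : ℕ) : ℝ) * l ^ (n + 1 + 1)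
        = s * (s ^ (n + 1) - C (n + 1 : ℝ) * s * l ^ n + C (n : ℝ) * l ^ (n + 1)) +
          C (n + 1 : ℝ) * (l ^ n * (s - l) ^ 2) := by
      push_cast
      simp only [C.map_add, C.map_one]
      ring
    rw [e1]
    refine ((hs.mul ih).mono (by ring_nf; omega)).add (C_mul ?_ (by positivity))
    have h2 : (s - l).totalDegree ≤ e :=
      (totalDegree_sub _ _).trans (max_le hs.totalDegree_le hl.totalDegree_le)
    exact ((hl.pow n).mul (sq h2)).mono (by ring_nf; omega)

lemma multiset_sum {e : ℕ} (L : Multiset (MvPolynomial (Fin d) ℝ))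
    (hL : ∀ f ∈ L, SphereCone e f) : SphereCone e L.sum := by
  induction L using Multiset.induction_on with
  | empty => simpa using zero e
  | cons f L ih =>
    rw [Multiset.sum_cons]
    exact (hL f (by simp)).add (ih fun g hg => hL g (by simp [hg]))

/-- The inequality of arithmetic and geometric means, as a certificate. -/
lemma amgm {e : ℕ} (L : Multiset (MvPolynomial (Fin d) ℝ)) (hL : ∀ f ∈ L, SphereCone e f) :
    SphereCone (e * L.card) ((C ((L.card : ℝ)⁻¹) * L.sum) ^ L.card - L.prod) := by
  induction L using Multiset.induction_on with
  | empty => simpa using zero 0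
  | cons f L ih =>
    have hf := hL f (by simp)
    have hL' : ∀ g ∈ L, SphereCone e g := fun g hg => hL g (by simp [hg])
    have ih' := ih hL'
    rw [Multiset.card_cons, Multiset.sum_cons, Multiset.prod_cons]
    set N := L.card with hN
    have hs : SphereCone e (C (((N + 1 : ℕ) : ℝ)⁻¹) * (f + L.sum)) :=
      (hf.add (multiset_sum L hL')).C_mul (by positivity)
    have hl : SphereCone e (C ((N : ℝ)⁻¹) * L.sum) :=
      (multiset_sum L hL').C_mul (by positivity)
    have hfe : f = C (N + 1 : ℝ) * (C (((N + 1 : ℕ) : ℝ)⁻¹) * (f + L.sum)) -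
        C (N : ℝ) * (C ((N : ℝ)⁻¹) * L.sum) := by
      have h1 : C (N + 1 : ℝ) * C (((N + 1 : ℕ) : ℝ)⁻¹) = (1 : MvPolynomial (Fin d) ℝ) := by
        rw [← C.map_mul, Nat.cast_succ, mul_inv_cancel₀ (by positivity), C.map_one]
      rw [← mul_assoc, h1, one_mul]
      rcases Nat.eq_zero_or_pos N with h0 | h0
      · have : L = 0 := Multiset.card_eq_zero.1 (hN ▸ h0)
        simp [this]
      · have h2 : C (N : ℝ) * C ((N : ℝ)⁻¹) = (1 : MvPolynomial (Fin d) ℝ) := by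
          rw [← C.map_mul, mul_inv_cancel₀ (by positivity), C.map_one]
        rw [← mul_assoc, h2]; ring
    have hb := bernoulli hs hl N
    set s := C (((N + 1 : ℕ) : ℝ)⁻¹) * (f + L.sum)
    set l := C ((N : ℝ)⁻¹) * L.sum
    have e1 : s ^ (N + 1) - f * L.prod =
        (s ^ (N + 1) - C (N + 1 : ℝ) * s * l ^ N + C (N : ℝ) * l ^ (N + 1)) +
          f * (l ^ N - L.prod) := by
      have : s ^ (N + 1) - f * L.prod = s ^ (N + 1) - f * l ^ N + f * (l ^ N - L.prod) := by ring
      rw [this]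
      congr 1
      conv_lhs => rw [hfe]
      simp only [C.map_add, C.map_one]
      ring
    rw [e1]
    exact hb.add ((hf.mul ih').mono (by ring_nf; omega))

end SphereCone

end Cone

/-! ### Tilting along one coordinate -/

section Tilt

variable {d : ℕ}

/-- The affine polynomial `1 + ((v i - u)² - (v i - a)²) / 16`: it is large where moving the
centre of the `i`-th coordinate from `u` to `a` decreases the distance to `v`. The factor `1 / 16`
keeps it positive for `|v i| ≤ 1`, `|u| ≤ 1` and `|a| ≤ 2`. -/
noncomputable def tiltPoly (i : Fin d) (u a : ℝ) : MvPolynomial (Fin d) ℝ :=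
  C (1 - (a ^ 2 - u ^ 2) / 16) + C ((a - u) / 8) * X i

lemma polyFun_tiltPoly (i : Fin d) (u a : ℝ) (v : Vec d) :
    polyFun (tiltPoly i u a) v = 1 + ((v i - u) ^ 2 - (v i - a) ^ 2) / 16 := by
  simp [polyFun, tiltPoly]; ring

lemma totalDegree_tiltPoly_le (i : Fin d) (u a : ℝ) : (tiltPoly i u a).totalDegree ≤ 1 := by
  refine (totalDegree_add _ _).trans (max_le ((totalDegree_C _).le.trans zero_le_one)
    ((totalDegree_mul _ _).trans ?_))
  simp

lemma sphereCone_one_sub_mul_X (i : Fin d) {ε : ℝ} (hε : ε ^ 2 = 1) :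
    SphereCone 2 (1 - C ε * X i : MvPolynomial (Fin d) ℝ) := by
  have hg := totalDegree_spherePoly_le d
  have h1 : SphereCone 2 ((1 - C ε * X i : MvPolynomial (Fin d) ℝ) ^ 2) := by
    refine SphereCone.sq (D := 1) ((totalDegree_sub _ _).trans (max_le (by simp) ?_))
    exact (totalDegree_mul _ _).trans (by simp)
  have h2 : SphereCone 2 (((Finset.univ.erase i).val.map
      fun j => (X j : MvPolynomial (Fin d) ℝ) ^ 2).sum) := by
    refine SphereCone.multiset_sum _ fun f hf => ?_
    obtain ⟨j, -, rfl⟩ := Multiset.mem_map.1 hf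
    exact SphereCone.sq (D := 1) (by simp)
  have h3 : SphereCone 2 (-1 * spherePoly d) :=
    SphereCone.of_mul_spherePoly _ (by simpa using hg)
  have key : (1 - C ε * X i : MvPolynomial (Fin d) ℝ) = C (1 / 2) * (1 - C ε * X i) ^ 2 +
      C (1 / 2) * (((Finset.univ.erase i).val.map
        fun j => (X j : MvPolynomial (Fin d) ℝ) ^ 2).sum + -1 * spherePoly d) := by
    have e1 : spherePoly d = ((Finset.univ.erase i).val.map
        fun j => (X j : MvPolynomial (Fin d) ℝ) ^ 2).sum + X i ^ 2 - 1 := by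
      rw [spherePoly, ← Finset.sum_erase_add _ _ (Finset.mem_univ i)]; rfl
    have e2 : (C ε : MvPolynomial (Fin d) ℝ) ^ 2 = 1 := by rw [← C.map_pow, hε, C.map_one]
    have e3 : (C (1 / 2) : MvPolynomial (Fin d) ℝ) * 2 = 1 := by
      rw [← map_ofNat (C : ℝ →+* MvPolynomial (Fin d) ℝ) 2, ← C.map_mul]; norm_num
    rw [e1]
    linear_combination (-(1 - C ε * X i)) * e3 - C (1 / 2) * X i ^ 2 * e2
  rw [key]
  exact (h1.C_mul (by norm_num)).add ((h2.add h3).C_mul (by norm_num))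

lemma sphereCone_tiltPoly (i : Fin d) {u a : ℝ} (hu : |u| ≤ 1) (ha : |a| ≤ 2) :
    SphereCone 2 (tiltPoly i u a) := by
  obtain ⟨hu1, hu2⟩ := abs_le.1 hu
  obtain ⟨ha1, ha2⟩ := abs_le.1 ha
  have key : ∀ ε : ℝ, ε ^ 2 = 1 → 0 ≤ (a - u) * ε → SphereCone 2 (tiltPoly i u a) := by
    intro ε hε h
    have e : tiltPoly i u a = C (1 - (a ^ 2 - u ^ 2) / 16 - (a - u) * ε / 8) +
        C ((a - u) * ε / 8) * (1 - C (-ε) * X i) := by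
      have : (a - u) / 8 = (a - u) * ε / 8 * ε := by linear_combination (-(a - u) / 8) * hε
      rw [tiltPoly, this]
      simp only [map_sub, map_mul, map_neg]
      ring
    rw [e]
    have hε' : |ε| = 1 := by rw [← Real.sqrt_sq_eq_abs, hε, Real.sqrt_one]
    have h3 : (a - u) * ε ≤ 3 := by
      refine (le_abs_self _).trans ?_
      rw [abs_mul, hε', mul_one, abs_le]
      constructor <;> linarith
    have h4 : a ^ 2 - u ^ 2 ≤ 4 := by nlinarith [sq_nonneg u]
    exact (SphereCone.C_nonneg (by linarith) 2).add
      ((sphereCone_one_sub_mul_X i (by rw [neg_sq, hε])).C_mul (by positivity))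
  rcases le_total 0 (a - u) with h | h
  · exact key 1 (by norm_num) (by linarith)
  · exact key (-1) (by norm_num) (by linarith)

lemma isSumSq_even_pow (p : MvPolynomial (Fin d) ℝ) {n : ℕ} (hn : Even n) :
    IsSumSq (p ^ n) := by
  obtain ⟨m, rfl⟩ := hn
  rw [pow_add]
  exact IsSumSq.mul_self _

lemma isSumSq_tiltPoly_pow (i : Fin d) (u a : ℝ) (M : ℕ) : IsSumSq (tiltPoly i u a ^ (16 * M)) :=
  isSumSq_even_pow _ ⟨8 * M, by ring⟩

lemma totalDegree_tiltPoly_pow_le (i : Fin d) (u a : ℝ) (n : ℕ) :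
    (tiltPoly i u a ^ n).totalDegree ≤ n :=
  (totalDegree_pow _ _).trans
    ((Nat.mul_le_mul_left n (totalDegree_tiltPoly_le i u a)).trans (by simp))

lemma hasDerivAt_pExpLin_tiltPoly_pow (μ : Vec d →₀ ℝ) (i : Fin d) (u a : ℝ) (n : ℕ) :
    HasDerivAt (fun a => pExpLin μ (tiltPoly i u a ^ (n + 1)))
      ((n + 1) / 8 * (pExpLin μ (tiltPoly i u a ^ n * X i) -
        a * pExpLin μ (tiltPoly i u a ^ n))) a := by
  have e1 : (fun a => pExpLin μ (tiltPoly i u a ^ (n + 1))) = fun a =>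
      ∑ x ∈ μ.support, μ x * (1 + ((x i - u) ^ 2 - (x i - a) ^ 2) / 16) ^ (n + 1) := by
    funext a
    rw [← pExp_eq_sum μ fun x => (1 + ((x i - u) ^ 2 - (x i - a) ^ 2) / 16) ^ (n + 1)]
    exact (pExpLin_eq_of_eval μ fun v => by
      rw [← polyFun_tiltPoly]; simp [polyFun]).symm
  have e2 : (n + 1) / 8 * (pExpLin μ (tiltPoly i u a ^ n * X i) -
      a * pExpLin μ (tiltPoly i u a ^ n)) = ∑ x ∈ μ.support,
        μ x * ((n + 1) * (1 + ((x i - u) ^ 2 - (x i - a) ^ 2) / 16) ^ n * ((x i - a) / 8)) := by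
    rw [← pExpLin_C_mul, ← map_sub, ← pExpLin_C_mul,
      ← pExp_eq_sum μ fun x => (n + 1) * (1 + ((x i - u) ^ 2 - (x i - a) ^ 2) / 16) ^ n *
        ((x i - a) / 8)]
    refine (pExpLin_eq_of_eval μ fun v => ?_).symm
    rw [← polyFun_tiltPoly]
    simp only [polyFun, map_mul, map_sub, map_pow, eval_C, eval_X]
    ring
  rw [e1, e2]
  refine HasDerivAt.fun_sum fun x _ => HasDerivAt.const_mul _ ?_
  have h1 : HasDerivAt (fun a : ℝ => 1 + ((x i - u) ^ 2 - (x i - a) ^ 2) / 16)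
      ((x i - a) / 8) a := by
    have := ((((hasDerivAt_id a).const_sub (x i)).pow 2).const_sub
      ((x i - u) ^ 2)).div_const 16 |>.const_add 1
    refine this.congr_deriv ?_
    simp; ring
  have := h1.fun_pow (n + 1)
  refine this.congr_deriv ?_
  simp

/-- A centre `a` that maximizes the pseudo-moment of order `n + 1` of `tiltPoly i u a` is the
mean of `v i` under the reweighting by the `n`-th power, by stationarity. At an endpoint of the
interval, stationarity comes from `|v i| ≤ 1`. -/
lemma exists_maximal_tilt {t : ℕ} {μ : Vec d →₀ ℝ}
    (hS : Satisfies t μ (sphereConstraint d)) (i : Fin d) (u : ℝ) {n : ℕ} (hn : Even n)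
    (ht : 2 * (n + 2) + 2 ≤ t) :
    ∃ a, |a| ≤ 2 ∧
      pExpLin μ (tiltPoly i u a ^ n * X i) = a * pExpLin μ (tiltPoly i u a ^ n) ∧
      ∀ a', |a'| ≤ 2 → pExpLin μ (tiltPoly i u a' ^ (n + 1)) ≤
        pExpLin μ (tiltPoly i u a ^ (n + 1)) := by
  have hd := fun a => hasDerivAt_pExpLin_tiltPoly_pow μ i u a n
  have hcont : ContinuousOn (fun a => pExpLin μ (tiltPoly i u a ^ (n + 1))) (Set.Icc (-2) 2) :=
    fun a _ => (hd a).continuousAt.continuousWithinAt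
  obtain ⟨a, ha, hmax⟩ := isCompact_Icc.exists_isMaxOn
    (Set.nonempty_Icc.2 (by norm_num : (-2 : ℝ) ≤ 2)) hcont
  refine ⟨a, abs_le.2 ha, ?_, fun a' ha' => hmax (abs_le.1 ha')⟩
  have hvar : ∀ y ∈ Set.Icc (-2 : ℝ) 2, (pExpLin μ (tiltPoly i u a ^ n * X i) -
      a * pExpLin μ (tiltPoly i u a ^ n)) * (y - a) ≤ 0 := by
    intro y hy
    have hseg : segment ℝ a y ⊆ Set.Icc (-2 : ℝ) 2 := (convex_Icc _ _).segment_subset ha hy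
    have := hmax.localize.hasFDerivWithinAt_nonpos (hd a).hasFDerivAt.hasFDerivWithinAt
      (sub_mem_posTangentConeAt_of_segment_subset hseg)
    simp only [ContinuousLinearMap.toSpanSingleton_apply, smul_eq_mul] at this
    have hn0 : (0 : ℝ) < (n + 1) / 8 := by positivity
    by_contra! h
    have := mul_pos hn0 h
    linarith
  have hcone : ∀ ε : ℝ, ε ^ 2 = 1 →
      0 ≤ 2 * pExpLin μ (tiltPoly i u a ^ n) - ε * pExpLin μ (tiltPoly i u a ^ n * X i) := by
    intro ε hε
    have h1 : SphereCone n (tiltPoly i u a ^ n) :=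
      SphereCone.of_isSumSq (isSumSq_even_pow _ hn) (totalDegree_tiltPoly_pow_le i u a n)
    have h2 := h1.mul ((sphereCone_one_sub_mul_X i hε).add (SphereCone.C_nonneg zero_le_one 2))
    have h3 := h2.pExpLin_nonneg hS ht
    have e : tiltPoly i u a ^ n * (1 - C ε * X i + C 1) =
        C 2 * tiltPoly i u a ^ n - C ε * (tiltPoly i u a ^ n * X i) := by
      rw [map_ofNat, C.map_one]; ring
    rwa [e, map_sub, pExpLin_C_mul, pExpLin_C_mul] at h3
  have hc1 := hcone 1 (by norm_num)
  have hc2 := hcone (-1) (by norm_num)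
  have hv1 := hvar 2 (by norm_num)
  have hv2 := hvar (-2) (by norm_num)
  rw [← sub_eq_zero]
  rcases eq_or_lt_of_le ha.2 with rfl | h2
  · refine le_antisymm ?_ ?_ <;> linarith
  rcases eq_or_lt_of_le ha.1 with rfl | h1
  · refine le_antisymm ?_ ?_ <;> linarith
  refine le_antisymm ?_ ?_
  · exact nonpos_of_mul_nonpos_left hv1 (by linarith)
  · by_contra! h
    have := mul_pos_of_neg_of_neg h (by linarith : -2 - a < 0)
    linarith

/-- Among the two centres `u ± c`, one has tilted moment at least a single even term of the
binomial expansion. -/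
lemma exists_tilt_moment_ge {t : ℕ} {μ : Vec d →₀ ℝ}
    (hS : Satisfies t μ (sphereConstraint d)) (i : Fin d) (u : ℝ) {c : ℝ} (hc0 : 0 ≤ c)
    (hc : c ≤ 1) {N r : ℕ} (hr : 2 * r ≤ N) (ht : N ≤ t) :
    ∃ a, |a - u| = c ∧ (N.choose (2 * r) : ℝ) * (1 - c ^ 2 / 16) ^ (N - 2 * r) *
      (c / 8) ^ (2 * r) * pExpLin μ ((X i - C u) ^ (2 * r)) ≤ pExpLin μ (tiltPoly i u a ^ N) := by
  set A := 1 - c ^ 2 / 16 with hA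
  have hA0 : 0 ≤ A := by nlinarith
  set x : MvPolynomial (Fin d) ℝ := X i - C u with hx
  have hxdeg : ∀ m, (x ^ m).totalDegree ≤ m := fun m =>
    (totalDegree_pow _ _).trans ((Nat.mul_le_mul_left m
      ((totalDegree_sub _ _).trans (max_le (by simp) (by simp)) : x.totalDegree ≤ 1)).trans
        (by simp))
  have hexp : ∀ ε : ℝ, ε ^ 2 = 1 → pExpLin μ (tiltPoly i u (u + ε * c) ^ N) =
      ∑ m ∈ Finset.range (N + 1),
        ε ^ m * ((N.choose m : ℝ) * A ^ (N - m) * (c / 8) ^ m * pExpLin μ (x ^ m)) := by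
    intro ε hε
    have e1 : tiltPoly i u (u + ε * c) = C (ε * (c / 8)) * x + C A := by
      have h1 : 1 - ((u + ε * c) ^ 2 - u ^ 2) / 16 = A - ε * (c / 8) * u := by
        rw [hA]; linear_combination (-c ^ 2 / 16) * hε
      have h2 : (u + ε * c - u) / 8 = ε * (c / 8) := by ring
      rw [tiltPoly, h1, h2, hx, map_sub, C.map_mul _ u]
      ring
    rw [e1, add_pow, map_sum]
    refine Finset.sum_congr rfl fun m _ => ?_
    have e2 : (C (ε * (c / 8)) * x) ^ m * C A ^ (N - m) * (N.choose m : MvPolynomial (Fin d) ℝ) =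
        C (ε ^ m * ((N.choose m : ℝ) * A ^ (N - m) * (c / 8) ^ m)) * x ^ m := by
      simp only [C.map_mul, C.map_pow, map_natCast, mul_pow]
      ring
    rw [e2, pExpLin_C_mul]
    ring
  have hsum : 2 * ((N.choose (2 * r) : ℝ) * A ^ (N - 2 * r) * (c / 8) ^ (2 * r) *
      pExpLin μ (x ^ (2 * r))) ≤
        pExpLin μ (tiltPoly i u (u + 1 * c) ^ N) + pExpLin μ (tiltPoly i u (u + (-1) * c) ^ N) := by
    rw [hexp 1 (by norm_num), hexp (-1) (by norm_num), ← Finset.sum_add_distrib]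
    have := Finset.single_le_sum (s := Finset.range (N + 1)) (a := 2 * r)
      (f := fun m => (1 : ℝ) ^ m * ((N.choose m : ℝ) * A ^ (N - m) * (c / 8) ^ m *
        pExpLin μ (x ^ m)) + (-1 : ℝ) ^ m * ((N.choose m : ℝ) * A ^ (N - m) * (c / 8) ^ m *
        pExpLin μ (x ^ m))) ?_ (Finset.mem_range.2 (by omega))
    · refine le_trans (le_of_eq ?_) this
      simp only [one_pow, (even_two_mul r).neg_one_pow]
      ring
    · intro m hm
      rcases Nat.even_or_odd m with he | ho
      · have h0 : 0 ≤ pExpLin μ (x ^ m) :=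
          hS.pExpLin_nonneg (isSumSq_even_pow x he)
            ((hxdeg m).trans (by rw [Finset.mem_range] at hm; omega))
        simp only [one_pow, he.neg_one_pow]
        positivity
      · simp only [one_pow, ho.neg_one_pow]
        linarith
  by_cases h : (N.choose (2 * r) : ℝ) * A ^ (N - 2 * r) * (c / 8) ^ (2 * r) *
      pExpLin μ (x ^ (2 * r)) ≤ pExpLin μ (tiltPoly i u (u + 1 * c) ^ N)
  · exact ⟨_, by simp [abs_of_nonneg hc0], h⟩
  · exact ⟨u + (-1) * c, by simp [abs_of_nonneg hc0], by linarith⟩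

end Tilt

section TiltGain

variable {d : ℕ}

lemma exp_neg_two_mul_le {x : ℝ} (h0 : 0 ≤ x) (h1 : x ≤ 1 / 2) :
    Real.exp (-2 * x) ≤ 1 - x := by
  have h2 : 2 * x + 1 ≤ Real.exp (2 * x) := Real.add_one_le_exp _
  rw [neg_mul, Real.exp_neg, inv_le_comm₀ (Real.exp_pos _) (by linarith)]
  refine le_trans ?_ h2
  rw [inv_le_iff_one_le_mul₀ (by linarith)]
  nlinarith

lemma pow_le_choose {z M : ℕ} (hz : 1 ≤ z) (hzM : z ≤ M) :
    (49 * (M : ℝ) ^ 2 / z ^ 2) ^ z ≤ ((16 * M + 1).choose (2 * z) : ℝ) := by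
  have hz0 : (0 : ℝ) < z := by exact_mod_cast hz
  refine le_trans ?_ (Nat.pow_le_choose (2 * z) (16 * M + 1))
  rw [le_div_iff₀ (by positivity)]
  have h1 : (((2 * z).factorial : ℕ) : ℝ) ≤ (2 * z : ℝ) ^ (2 * z) := by
    exact_mod_cast Nat.factorial_le_pow (2 * z)
  have h2 : (14 * M : ℝ) ≤ ((16 * M + 1 + 1 - 2 * z : ℕ) : ℝ) := by
    exact_mod_cast (by omega : 14 * M ≤ 16 * M + 1 + 1 - 2 * z)
  calc (49 * (M : ℝ) ^ 2 / z ^ 2) ^ z * ((2 * z).factorial : ℕ)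
      ≤ (49 * (M : ℝ) ^ 2 / z ^ 2) ^ z * (2 * z : ℝ) ^ (2 * z) := by gcongr
    _ = (14 * M : ℝ) ^ (2 * z) := by
        rw [pow_mul, pow_mul, ← mul_pow]
        congr 1
        field_simp
        ring
    _ ≤ _ := by gcongr

/-- The moment gained by a shift of the optimal size `c = √(z / M)`. -/
lemma tilt_gain_le {z M : ℕ} {τ c : ℝ} (hz : 1 ≤ z) (hτ1 : τ ≤ 1) (hτ0 : 0 < τ)
    (hM : 64 * z ≤ M * τ) (hc : c ^ 2 = z / M) :
    5 / 4 * Real.exp z ≤ ((16 * M + 1).choose (2 * z) : ℝ) *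
      (1 - c ^ 2 / 16) ^ (16 * M + 1 - 2 * z) * (c / 8) ^ (2 * z) * τ ^ z := by
  have hz0 : (0 : ℝ) < z := by exact_mod_cast hz
  have hMτ : (M : ℝ) * τ ≤ M := mul_le_of_le_one_right (by positivity) hτ1
  have hM64 : 64 * (z : ℝ) ≤ M := hM.trans hMτ
  have hM0 : (0 : ℝ) < M := by linarith
  have hzM : z ≤ M := by exact_mod_cast (by linarith : (z : ℝ) ≤ M)
  have hx1 : (z : ℝ) / M ≤ 1 / 2 := by rw [div_le_iff₀ hM0]; linarith
  have hx0 : 0 ≤ (z : ℝ) / M := by positivity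
  have hA : Real.exp (-2 * z) ≤ (1 - c ^ 2 / 16) ^ (16 * M + 1 - 2 * z) := by
    have h1 : Real.exp (-2 * (z / M / 16)) ≤ 1 - z / M / 16 :=
      exp_neg_two_mul_le (by positivity) (by linarith)
    rw [hc]
    calc Real.exp (-2 * z) = Real.exp (-2 * (z / M / 16)) ^ (16 * M) := by
          rw [← Real.exp_nat_mul]; congr 1; push_cast; field_simp
      _ ≤ (1 - z / M / 16) ^ (16 * M) := by gcongr
      _ ≤ _ := pow_le_pow_of_le_one (by linarith) (by linarith) (by omega)
  have hB : (49 : ℝ) ^ z ≤ (49 * (M : ℝ) ^ 2 / z ^ 2) ^ z * (c / 8) ^ (2 * z) * τ ^ z := by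
    rw [pow_mul, ← mul_pow, ← mul_pow]
    gcongr
    rw [div_pow, hc]
    have : 49 * (M : ℝ) ^ 2 / z ^ 2 * (z / M / 8 ^ 2) * τ = 49 / (64 * z) * (M * τ) := by
      field_simp; norm_num
    rw [this, div_mul_eq_mul_div, le_div_iff₀ (by positivity)]
    linarith
  have hE : 5 / 4 * Real.exp z ≤ 49 ^ z * Real.exp (-2 * z) := by
    have h3 : Real.exp 1 ≤ 3 := by have := Real.exp_one_lt_d9; linarith
    have h4 : Real.exp z = 27 ^ z * Real.exp (-2 * z) * (Real.exp 1 / 3) ^ (3 * z) := by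
      rw [div_pow, ← Real.exp_nat_mul, pow_mul 3]
      norm_num
      rw [← mul_div_assoc, mul_div_right_comm, mul_div_right_comm, div_self (by positivity),
        one_mul, ← Real.exp_add]
      congr 1; ring
    have h5 : (Real.exp 1 / 3) ^ (3 * z) ≤ 1 :=
      pow_le_one₀ (by positivity) (by rw [div_le_one (by norm_num)]; exact h3)
    have h6 : (5 / 4 : ℝ) ≤ (5 / 4) ^ z := le_self_pow₀ (by norm_num) (by omega)
    calc 5 / 4 * Real.exp z
        = 5 / 4 * (27 ^ z * Real.exp (-2 * z)) * (Real.exp 1 / 3) ^ (3 * z) := by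
          rw [h4]; ring
      _ ≤ (5 / 4) ^ z * (27 ^ z * Real.exp (-2 * z)) * 1 := by gcongr
      _ = (5 / 4 * 27) ^ z * Real.exp (-2 * z) := by rw [mul_pow]; ring
      _ ≤ 49 ^ z * Real.exp (-2 * z) := by gcongr; norm_num
  have hc0 : 0 ≤ (c / 8) ^ (2 * z) := by rw [pow_mul]; positivity
  calc 5 / 4 * Real.exp z ≤ 49 ^ z * Real.exp (-2 * z) := hE
    _ ≤ ((49 * (M : ℝ) ^ 2 / z ^ 2) ^ z * (c / 8) ^ (2 * z) * τ ^ z) *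
        (1 - c ^ 2 / 16) ^ (16 * M + 1 - 2 * z) := by gcongr
    _ ≤ ((((16 * M + 1).choose (2 * z) : ℝ)) * (c / 8) ^ (2 * z) * τ ^ z) *
        (1 - c ^ 2 / 16) ^ (16 * M + 1 - 2 * z) := by
          have := pow_le_choose hz hzM
          have h0 : 0 ≤ (1 - c ^ 2 / 16) ^ (16 * M + 1 - 2 * z) := (Real.exp_pos _).le.trans hA
          gcongr
    _ = _ := by ring

/-- One round: if the `2z`-th pseudo-moment of `v i - u` is at least `τ ^ z`, there is a tilt with
pseudo-expectation at least `exp z` whose centre is the mean of `v i` under the reweighting. -/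
lemma exists_tilt {t z M : ℕ} {μ : Vec d →₀ ℝ}
    (hS : Satisfies t μ (sphereConstraint d)) (i : Fin d) {u τ : ℝ} (hu : |u| ≤ 1)
    (hz : 1 ≤ z) (hτ0 : 0 < τ) (hτ1 : τ ≤ 1) (hM : 64 * z ≤ M * τ)
    (hmom : τ ^ z ≤ pExpLin μ ((X i - C u) ^ (2 * z))) (ht : 100 * M ≤ t) :
    ∃ a, |a| ≤ 1 ∧ Real.exp z ≤ pExpLin μ (tiltPoly i u a ^ (16 * M)) ∧
      pExpLin μ (tiltPoly i u a ^ (16 * M) * X i) =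
        a * pExpLin μ (tiltPoly i u a ^ (16 * M)) := by
  have hz0 : (0 : ℝ) < z := by exact_mod_cast hz
  have hM64 : 64 * (z : ℝ) ≤ M := hM.trans (mul_le_of_le_one_right (by positivity) hτ1)
  have hM64' : 64 * z ≤ M := by exact_mod_cast hM64
  have hM0 : (0 : ℝ) < M := by linarith
  have hn : Even (16 * M) := ⟨8 * M, by ring⟩
  obtain ⟨a, ha2, hstat, hmax⟩ := exists_maximal_tilt hS i u hn (by omega)
  obtain ⟨hu1, hu2⟩ := abs_le.1 hu
  obtain ⟨ha1, ha2'⟩ := abs_le.1 ha2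
  have hc : (Real.sqrt (z / M)) ^ 2 = z / M := Real.sq_sqrt (by positivity)
  have hc1 : Real.sqrt (z / M) ≤ 1 := by
    refine Real.sqrt_le_iff.2 ⟨zero_le_one, ?_⟩
    rw [one_pow, div_le_one hM0]; linarith
  have hψ : 5 / 4 * Real.exp z ≤ pExpLin μ (tiltPoly i u a ^ (16 * M + 1)) := by
    obtain ⟨a', ha', hge⟩ := exists_tilt_moment_ge hS i u (Real.sqrt_nonneg (z / M)) hc1
      (N := 16 * M + 1) (r := z) (by omega) (by omega)
    have hle : |a'| ≤ 2 := by
      rw [← ha'] at hc1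
      obtain ⟨h1, h2⟩ := abs_le.1 hc1
      rw [abs_le]; constructor <;> linarith
    refine le_trans ?_ (hge.trans (hmax a' hle))
    refine (tilt_gain_le hz hτ1 hτ0 hM hc).trans ?_
    have h16 : 0 ≤ 1 - (Real.sqrt (z / M)) ^ 2 / 16 := by
      have := Real.sqrt_nonneg (z / M : ℝ); nlinarith
    gcongr
  -- stationarity evaluates the tilt itself under the reweighting
  have hq : pExpLin μ (tiltPoly i u a ^ (16 * M + 1)) =
      (1 + (a - u) ^ 2 / 16) * pExpLin μ (tiltPoly i u a ^ (16 * M)) := by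
    have e : tiltPoly i u a ^ (16 * M + 1) =
        C (1 - (a ^ 2 - u ^ 2) / 16) * tiltPoly i u a ^ (16 * M) +
          C ((a - u) / 8) * (tiltPoly i u a ^ (16 * M) * X i) := by
      conv_lhs => rw [pow_succ]; arg 2; rw [tiltPoly]
      ring
    rw [e, map_add, pExpLin_C_mul, pExpLin_C_mul, hstat]
    ring
  have hpos : 0 < pExpLin μ (tiltPoly i u a ^ (16 * M)) := by
    have h1 : 0 < pExpLin μ (tiltPoly i u a ^ (16 * M + 1)) :=
      lt_of_lt_of_le (by positivity) hψ
    rw [hq] at h1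
    exact pos_of_mul_pos_right h1 (by positivity)
  have hcone : ∀ ε : ℝ, ε ^ 2 = 1 → ε * a ≤ 1 := by
    intro ε hε
    have h1 := ((SphereCone.of_isSumSq (isSumSq_tiltPoly_pow i u a M)
      (totalDegree_tiltPoly_pow_le i u a _)).mul (sphereCone_one_sub_mul_X i hε)).pExpLin_nonneg
        hS (by omega)
    have e : tiltPoly i u a ^ (16 * M) * (1 - C ε * X i) = tiltPoly i u a ^ (16 * M) -
        C ε * (tiltPoly i u a ^ (16 * M) * X i) := by ring
    rw [e, map_sub, pExpLin_C_mul, hstat] at h1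
    by_contra! h
    have := mul_lt_mul_of_pos_right h hpos
    linarith
  have hb1 := hcone 1 (by norm_num)
  have hb2 := hcone (-1) (by norm_num)
  refine ⟨a, abs_le.2 ⟨by linarith, by linarith⟩, ?_, hstat⟩
  have h4 : (a - u) ^ 2 ≤ 4 := by nlinarith
  rw [hq] at hψ
  nlinarith

end TiltGain

/-! ### Pseudo-moments of the distance -/

section Moments

variable {d : ℕ}

/-- The polynomial `‖v - u‖²`. -/
noncomputable def distPoly (u : Vec d) : MvPolynomial (Fin d) ℝ :=
  ∑ i, (X i - C (u i)) ^ 2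

lemma polyFun_distPoly (u v : Vec d) : polyFun (distPoly u) v = ‖v - u‖ ^ 2 := by
  rw [EuclideanSpace.norm_sq_eq]
  simp [polyFun, distPoly]

lemma normMoment_eq (μ : Vec d →₀ ℝ) (u : Vec d) (y : ℕ) :
    normMoment μ u y = pExpLin μ (distPoly u ^ y) := by
  refine pExpLin_eq_of_eval μ fun v => ?_
  rw [pow_mul, ← polyFun_distPoly]
  simp [polyFun]

lemma pExp_coord_pow_eq (μ : Vec d →₀ ℝ) (u : Vec d) (i : Fin d) (n : ℕ) :
    pExp μ (fun v => (v i - u i) ^ n) = pExpLin μ ((X i - C (u i)) ^ n) :=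
  pExpLin_eq_of_eval μ fun v => by simp [polyFun]

lemma pExp_sum_coord_pow_eq (μ : Vec d →₀ ℝ) (u : Vec d) (n : ℕ) :
    pExp μ (fun v => ∑ i, (v i - u i) ^ n) = ∑ i, pExpLin μ ((X i - C (u i)) ^ n) := by
  rw [← map_sum]
  exact pExpLin_eq_of_eval μ fun v => by simp [polyFun]

lemma totalDegree_X_sub_C_le (i : Fin d) (a : ℝ) :
    (X i - C a : MvPolynomial (Fin d) ℝ).totalDegree ≤ 1 :=
  (totalDegree_sub _ _).trans (max_le (by simp) (by simp))

lemma isSumSq_distPoly (u : Vec d) : IsSumSq (distPoly u) := by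
  refine IsSumSq.sum fun i _ => ?_
  rw [sq]; exact IsSumSq.mul_self _

lemma totalDegree_distPoly_le (u : Vec d) : (distPoly u).totalDegree ≤ 2 := by
  refine (totalDegree_finsetSum _ _).trans (Finset.sup_le fun i _ => ?_)
  refine (totalDegree_pow _ _).trans ?_
  have := totalDegree_X_sub_C_le i (u i)
  omega

lemma totalDegree_distPoly_pow_le (u : Vec d) (n : ℕ) :
    (distPoly u ^ n).totalDegree ≤ 2 * n :=
  (totalDegree_pow _ _).trans
    ((Nat.mul_le_mul_left n (totalDegree_distPoly_le u)).trans (by omega))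

lemma normMoment_nonneg {t : ℕ} {μ : Vec d →₀ ℝ} (hS : Satisfies t μ (sphereConstraint d))
    (u : Vec d) {y : ℕ} (hy : 2 * y ≤ t) : 0 ≤ normMoment μ u y := by
  rw [normMoment_eq]
  exact hS.pExpLin_nonneg (isSumSq_pow (isSumSq_distPoly u) y)
    ((totalDegree_distPoly_pow_le u y).trans hy)

lemma normMoment_zero {t : ℕ} {μ : Vec d →₀ ℝ} (h : IsPseudoDist t μ) (u : Vec d) :
    normMoment μ u 0 = 1 := by
  rw [normMoment_eq, pow_zero, h.pExpLin_one]

/-- Log-convexity of the pseudo-moments. -/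
lemma normMoment_sq_le {t : ℕ} {μ : Vec d →₀ ℝ} (hS : Satisfies t μ (sphereConstraint d))
    (u : Vec d) {a : ℕ} (ha : 2 * (a + 2) ≤ t) :
    normMoment μ u (a + 1) ^ 2 ≤ normMoment μ u a * normMoment μ u (a + 2) := by
  have key : ∀ x : ℝ, 0 ≤ normMoment μ u a * (x * x) + (-2 * normMoment μ u (a + 1)) * x +
      normMoment μ u (a + 2) := by
    intro x
    have hq : IsSumSq (distPoly u ^ a * (distPoly u - C x) ^ 2) :=
      (isSumSq_pow (isSumSq_distPoly u) a).mul (isSumSq_even_pow _ even_two)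
    have hdeg : (distPoly u ^ a * (distPoly u - C x) ^ 2).totalDegree ≤ t := by
      refine (totalDegree_mul _ _).trans ?_
      have h1 := totalDegree_distPoly_pow_le u a
      have h2 : ((distPoly u - C x) ^ 2).totalDegree ≤ 2 * 2 :=
        (totalDegree_pow _ _).trans (Nat.mul_le_mul_left 2
          ((totalDegree_sub _ _).trans (max_le (totalDegree_distPoly_le u) (by simp))))
      omega
    have h := hS.pExpLin_nonneg hq hdeg
    have e : distPoly u ^ a * (distPoly u - C x) ^ 2 = C (x * x) * distPoly u ^ a +
        C (-2 * x) * distPoly u ^ (a + 1) + distPoly u ^ (a + 2) := by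
      simp only [C.map_mul, map_neg, map_ofNat]
      ring
    rw [e, map_add, map_add, pExpLin_C_mul, pExpLin_C_mul, ← normMoment_eq, ← normMoment_eq,
      ← normMoment_eq] at h
    linarith
  have := discrim_le_zero key
  rw [discrim] at this
  linarith

/-- In a log-convex nonnegative sequence, a growth by a factor `κ` persists. -/
lemma growth_of_logConvex {m : ℕ → ℝ} {K a : ℕ} {κ : ℝ} (hκ : 0 ≤ κ)
    (hm : ∀ b ≤ K, 0 ≤ m b) (hc : ∀ b, b + 2 ≤ K → m (b + 1) ^ 2 ≤ m b * m (b + 2))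
    (h : κ * m a < m (a + 1)) {b : ℕ} (hab : a ≤ b) (hb : b + 1 ≤ K) :
    κ * m b < m (b + 1) := by
  induction b, hab using Nat.le_induction with
  | base => exact h
  | succ b hab ih =>
    have ih := ih (by omega)
    have h1 := hc b (by omega)
    have h0 := hm b (by omega)
    have hp : 0 < m (b + 1) := lt_of_le_of_lt (mul_nonneg hκ h0) ih
    have h2 : 0 ≤ m (b + 2) := hm _ (by omega)
    by_contra! hle
    have h3 : m b * m (b + 2) ≤ m b * (κ * m (b + 1)) := mul_le_mul_of_nonneg_left hle h0
    have h4 := mul_lt_mul_of_pos_right ih hp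
    nlinarith

lemma pow_mul_le_of_growth {m : ℕ → ℝ} {K a : ℕ} {κ : ℝ} (hκ : 0 ≤ κ)
    (h : ∀ b, a ≤ b → b + 1 ≤ K → κ * m b ≤ m (b + 1)) {n : ℕ} (hn : a + n ≤ K) :
    κ ^ n * m a ≤ m (a + n) := by
  induction n with
  | zero => simp
  | succ n ih =>
    have h1 := h (a + n) (by omega) (by omega)
    calc κ ^ (n + 1) * m a = κ * (κ ^ n * m a) := by ring
      _ ≤ κ * m (a + n) := mul_le_mul_of_nonneg_left (ih (by omega)) hκ
      _ ≤ _ := h1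

/-- A lower bound on the `z`-th moment from `m y > η`, for a log-convex sequence with `m 0 = 1`.
If `y ≤ z` this is the power mean inequality. If `z < y`, the ratios of consecutive moments up to
`y` are at most `4 ≤ δ⁻²`, because a larger ratio would persist and contradict `m K ≤ 1`. -/
lemma moment_lower_bound {m : ℕ → ℝ} {K k y z : ℕ} {δ η : ℝ} (hm : ∀ b ≤ K, 0 ≤ m b)
    (hc : ∀ b, b + 2 ≤ K → m (b + 1) ^ 2 ≤ m b * m (b + 2)) (h0 : m 0 = 1) (hK : m K ≤ 1)
    (hδ0 : 0 < δ) (hδ : δ < 1 / 2) (hη0 : 0 < η) (hη1 : η < 1) (hz : 1 ≤ z) (hy : 1 ≤ y)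
    (hyk : y ≤ k) (hzK : z ≤ K) (hkK : k + 1 / η ≤ K) (hmy : η < m y) :
    (η * δ ^ (2 * k)) ^ z ≤ δ ^ (2 * z) * m z := by
  have hkK' : k ≤ K := by
    have : (k : ℝ) ≤ K := by have : 0 < 1 / η := by positivity
                             linarith
    exact_mod_cast this
  have hδ1 : δ ^ (2 * k) ≤ 1 := pow_le_one₀ hδ0.le (by linarith)
  rcases le_or_gt y z with hyz | hzy
  · -- some ratio before `y` exceeds `η`, hence all later ones do
    have hex : ∃ a, a < y ∧ η * m a < m (a + 1) := by
      by_contra! hno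
      have : ∀ n ≤ y, m n ≤ η ^ n := by
        intro n hn
        induction n with
        | zero => simp [h0]
        | succ n ih =>
          refine (hno n (by omega)).trans ?_
          rw [pow_succ']
          exact mul_le_mul_of_nonneg_left (ih (by omega)) hη0.le
      have h1 := this y le_rfl
      have h2 : η ^ y ≤ η := pow_le_of_le_one hη0.le hη1.le (by omega)
      linarith
    obtain ⟨a, hay, ha⟩ := hex
    have hgrow := pow_mul_le_of_growth (m := m) (K := K) (a := y) (κ := η) hη0.le
      (fun b hb hbK => (growth_of_logConvex hη0.le hm hc ha (hay.le.trans hb) hbK).le)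
      (n := z - y) (by omega)
    rw [Nat.add_sub_cancel' hyz] at hgrow
    have h2 : η ^ z ≤ m z := by
      calc η ^ z ≤ η ^ (z - y + 1) := pow_le_pow_of_le_one hη0.le hη1.le (by omega)
        _ = η ^ (z - y) * η := pow_succ _ _
        _ ≤ η ^ (z - y) * m y := by gcongr
        _ ≤ m z := hgrow
    calc (η * δ ^ (2 * k)) ^ z = (δ ^ (2 * k)) ^ z * η ^ z := by rw [mul_pow]; ring
      _ ≤ δ ^ (2 * z) * m z := by
        rw [← pow_mul]
        have h3 : δ ^ (2 * k * z) ≤ δ ^ (2 * z) :=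
          pow_le_pow_of_le_one hδ0.le (by linarith) (by nlinarith)
        gcongr
  · -- a ratio above `δ⁻² ≥ 4` before `y` would persist and make `m K` exceed `1`
    have hratio : ∀ a < y, δ ^ 2 * m (a + 1) ≤ m a := by
      intro a hay
      by_contra! hlt
      have hlt' : 4 * m a < m (a + 1) := by
        have h1 : δ ^ 2 ≤ 1 / 4 := by nlinarith
        have h2 := hm (a + 1) (by omega)
        nlinarith
      have hgrow := pow_mul_le_of_growth (m := m) (K := K) (a := y) (κ := 4) (by norm_num)
        (fun b hb hbK => (growth_of_logConvex (by norm_num) hm hc hlt' (hay.le.trans hb) hbK).le)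
        (n := K - y) (by omega)
      rw [Nat.add_sub_cancel' (by omega)] at hgrow
      have h4 : ((K - y : ℕ) : ℝ) < 4 ^ (K - y) := by
        exact_mod_cast Nat.lt_pow_self (by norm_num)
      have h5 : 1 / η ≤ ((K - y : ℕ) : ℝ) := by
        rw [Nat.cast_sub (by omega)]
        have : (y : ℝ) ≤ k := by exact_mod_cast hyk
        linarith
      have h6 : 1 < 4 ^ (K - y) * η := by
        rw [← div_lt_iff₀ hη0]; linarith
      have h7 : (4 : ℝ) ^ (K - y) * η ≤ 4 ^ (K - y) * m y := by gcongr
      linarith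
    have hback : ∀ n, z + n ≤ y → (δ ^ 2) ^ n * m (z + n) ≤ m z := by
      intro n hn
      induction n with
      | zero => simp
      | succ n ih =>
        refine le_trans ?_ (ih (by omega))
        rw [pow_succ, mul_assoc]
        exact mul_le_mul_of_nonneg_left (hratio (z + n) (by omega)) (by positivity)
    have h1 := hback (y - z) (by omega)
    rw [Nat.add_sub_cancel' hzy.le] at h1
    calc (η * δ ^ (2 * k)) ^ z ≤ η * δ ^ (2 * k) :=
          pow_le_of_le_one (by positivity)
            (mul_le_one₀ hη1.le (by positivity) hδ1) (by omega)
      _ ≤ δ ^ (2 * y) * η := by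
          rw [mul_comm]
          exact mul_le_mul_of_nonneg_right
            (pow_le_pow_of_le_one hδ0.le (by linarith) (by omega)) hη0.le
      _ ≤ δ ^ (2 * y) * m y := by gcongr
      _ = δ ^ (2 * z) * ((δ ^ 2) ^ (y - z) * m y) := by
          rw [← pow_mul, ← mul_assoc, ← pow_add]
          congr 2
          omega
      _ ≤ δ ^ (2 * z) * m z := by gcongr

/-- `∑ i, x i ^ (2z) ≤ (∑ i, x i ^ 2) ^ z`, with a sum-of-squares proof. -/
lemma isSumSq_pow_sum_sub {z : ℕ} (hz : 1 ≤ z) (u : Vec d) :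
    IsSumSq (distPoly u ^ z - ∑ i, (X i - C (u i)) ^ (2 * z)) := by
  induction z, hz using Nat.le_induction with
  | base => simp [distPoly]
  | succ z hz ih =>
    have e : distPoly u ^ (z + 1) - ∑ i, (X i - C (u i)) ^ (2 * (z + 1)) =
        distPoly u * (distPoly u ^ z - ∑ i, (X i - C (u i)) ^ (2 * z)) +
          ∑ i, (X i - C (u i)) ^ (2 * z) * (∑ j ∈ Finset.univ.erase i, (X j - C (u j)) ^ 2) := by
      have h1 : ∀ i, (X i - C (u i)) ^ (2 * z) *
          (∑ j ∈ Finset.univ.erase i, (X j - C (u j)) ^ 2) =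
            (X i - C (u i)) ^ (2 * z) * distPoly u - (X i - C (u i)) ^ (2 * (z + 1)) := by
        intro i
        rw [distPoly, ← Finset.sum_erase_add _ _ (Finset.mem_univ i)]
        ring
      rw [Finset.sum_congr rfl fun i _ => h1 i, Finset.sum_sub_distrib, ← Finset.sum_mul]
      ring
    rw [e]
    refine ((isSumSq_distPoly u).mul ih).add (IsSumSq.sum fun i _ => ?_)
    refine (isSumSq_even_pow _ (even_two_mul z)).mul (IsSumSq.sum fun j _ => ?_)
    exact isSumSq_even_pow _ even_two

/-- For `δ ≥ 1/2` the density condition holds automatically. -/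
lemma analyticallyDense_of_half_le {t z : ℕ} {μ : Vec d →₀ ℝ} {δ : ℝ}
    (hS : Satisfies t μ (sphereConstraint d)) (hz : 1 ≤ z) (ht : 2 * z ≤ t)
    (hδ : 1 / 2 ≤ δ) (u : Vec d) : AnalyticallyDense z δ μ u := by
  rw [AnalyticallyDense, pExp_sum_coord_pow_eq]
  have hdeg : (distPoly u ^ z - ∑ i, (X i - C (u i)) ^ (2 * z)).totalDegree ≤ t := by
    refine (totalDegree_sub _ _).trans (max_le ((totalDegree_distPoly_pow_le u z).trans ht) ?_)
    refine (totalDegree_finsetSum _ _).trans (Finset.sup_le fun i _ => ?_)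
    refine (totalDegree_pow _ _).trans ?_
    have := Nat.mul_le_mul_left (2 * z) (totalDegree_X_sub_C_le i (u i))
    omega
  have h := hS.pExpLin_nonneg (isSumSq_pow_sum_sub hz u) hdeg
  rw [map_sub, map_sum, ← normMoment_eq] at h
  have h1 : (1 : ℝ) ≤ (2 * δ) ^ (2 * z) := one_le_pow₀ (by linarith)
  have h2 := normMoment_nonneg hS u ht
  nlinarith

/-- If `v - u` is not analytically dense, some coordinate has a large pseudo-moment, since
`d ≤ exp z ≤ 4 ^ z`. -/
lemma exists_large_coord {t z : ℕ} {μ : Vec d →₀ ℝ} {δ : ℝ} (hd : 0 < d)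
    (hS : Satisfies t μ (sphereConstraint d)) (ht : 2 * z ≤ t) (hz : Real.log d ≤ z)
    (hδ : 0 < δ) {u : Vec d} (h : ¬ AnalyticallyDense z δ μ u) :
    ∃ i, δ ^ (2 * z) * normMoment μ u z < pExp μ (fun v => (v i - u i) ^ (2 * z)) := by
  by_contra! hno
  apply h
  rw [AnalyticallyDense, pExp_sum_coord_pow_eq]
  have h0 := normMoment_nonneg hS u ht
  have hd4 : (d : ℝ) ≤ 4 ^ z := by
    have h1 : (d : ℝ) ≤ Real.exp z := (Real.log_le_iff_le_exp (by exact_mod_cast hd)).1 hz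
    have h2 : Real.exp z = Real.exp 1 ^ z := by rw [← Real.exp_nat_mul, mul_one]
    rw [h2] at h1
    refine h1.trans ?_
    gcongr
    have := Real.exp_one_lt_d9
    linarith
  calc ∑ i, pExpLin μ ((X i - C (u i)) ^ (2 * z))
      ≤ ∑ _i : Fin d, δ ^ (2 * z) * normMoment μ u z := by
        refine Finset.sum_le_sum fun i _ => ?_
        rw [← pExp_coord_pow_eq]; exact hno i
    _ = d * (δ ^ (2 * z) * normMoment μ u z) := by simp
    _ ≤ 4 ^ z * (δ ^ (2 * z) * normMoment μ u z) := by gcongr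
    _ = (2 * δ) ^ (2 * z) * normMoment μ u z := by
        rw [mul_pow, pow_mul 2]; norm_num; ring

end Moments

/-! ### Products of tilts -/

section Products

variable {d : ℕ}

lemma distPoly_zero : distPoly (0 : Vec d) = 1 + spherePoly d := by
  simp [distPoly, spherePoly]

lemma sphereCone_distPoly (u : Vec d) : SphereCone 2 (distPoly u) :=
  SphereCone.of_isSumSq (isSumSq_distPoly u) (totalDegree_distPoly_le u)

/-- Modulo the sphere, `(a + b (‖v‖² - 1)) ^ n` is the constant `a ^ n`. -/
lemma pExpLin_pow_add_spherePoly {t : ℕ} {μ : Vec d →₀ ℝ} (hμ : IsPseudoDist t μ)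
    (hS : Satisfies t μ (sphereConstraint d)) (a b : ℝ) {n : ℕ} (ht : 2 * (2 * n) + 2 ≤ t) :
    pExpLin μ ((C a + C b * spherePoly d) ^ n) ≤ a ^ n := by
  have hdvd : spherePoly d ∣ C a ^ n - (C a + C b * spherePoly d) ^ n := by
    refine dvd_trans ⟨-C b, ?_⟩ (sub_dvd_pow_sub_pow _ _ n)
    ring
  obtain ⟨r, hr⟩ := hdvd
  have hdeg : (C a ^ n - (C a + C b * spherePoly d) ^ n).totalDegree ≤ 2 * n := by
    have hg := totalDegree_spherePoly_le d
    refine (totalDegree_sub _ _).trans (max_le ?_ ?_)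
    · rw [← C.map_pow, totalDegree_C]; omega
    · refine (totalDegree_pow _ _).trans ?_
      rw [mul_comm]
      refine Nat.mul_le_mul_right n ((totalDegree_add _ _).trans (max_le (by simp) ?_))
      refine (totalDegree_mul _ _).trans ?_
      simpa using hg
  rw [hr, mul_comm] at hdeg
  have h := (SphereCone.of_mul_spherePoly r hdeg).pExpLin_nonneg hS ht
  rw [mul_comm, ← hr, map_sub, ← C.map_pow, hμ.pExpLin_C] at h
  linarith

/-- When the sum of the factors `ys` telescopes to `r + (‖v‖² - ‖v - u‖²) / 16`, the `16M`-th power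
of their product times `(κ + ‖v - u‖²) ^ M` is, by the arithmetic-geometric mean inequality, at
most a power of a polynomial that is constant on the sphere. -/
lemma pExpLin_prod_mul_le {t : ℕ} {μ : Vec d →₀ ℝ} (hμ : IsPseudoDist t μ)
    (hS : Satisfies t μ (sphereConstraint d)) {M : ℕ} (hM : 1 ≤ M) {u : Vec d}
    {ys : Multiset (MvPolynomial (Fin d) ℝ)} (hys : ∀ y ∈ ys, SphereCone 2 y)
    (hsum : ys.sum = C (ys.card : ℝ) + C (1 / 16) * (distPoly 0 - distPoly u))
    {κ : ℝ} (hκ : 0 ≤ κ) (ht : 2 * (2 * (16 * M * ys.card + M)) + 2 ≤ t) :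
    pExpLin μ (ys.prod ^ (16 * M) * (C κ + distPoly u) ^ M) ≤
      (1 + κ * M / (16 * M * ys.card + M : ℕ)) ^ (16 * M * ys.card + M) := by
  have hM0 : (0 : ℝ) < M := by exact_mod_cast hM
  set L : Multiset (MvPolynomial (Fin d) ℝ) :=
    (16 * M) • ys + Multiset.replicate M (C κ + distPoly u) with hL
  have hcard : L.card = 16 * M * ys.card + M := by simp [hL]
  have hprod : L.prod = ys.prod ^ (16 * M) * (C κ + distPoly u) ^ M := by
    simp [hL, Multiset.prod_nsmul]
  have hcone : ∀ f ∈ L, SphereCone 2 f := by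
    intro f hf
    rcases Multiset.mem_add.1 hf with h | h
    · exact hys f (Multiset.mem_of_mem_nsmul h)
    · rw [Multiset.eq_of_mem_replicate h]
      exact (SphereCone.C_nonneg hκ 2).add (sphereCone_distPoly u)
  have hamgm := SphereCone.amgm L hcone
  set N := 16 * M * ys.card + M with hN
  have hN0 : (0 : ℝ) < N := by exact_mod_cast (by omega : 0 < N)
  have hmean : C ((L.card : ℝ)⁻¹) * L.sum =
      C (1 + κ * M / N) + C (M / N : ℝ) * spherePoly d := by
    have e1 : L.sum = C (N + κ * M : ℝ) + C (M : ℝ) * spherePoly d := by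
      have h16 : (C (1 / 16) : MvPolynomial (Fin d) ℝ) * 16 = 1 := by
        rw [← map_ofNat (C : ℝ →+* MvPolynomial (Fin d) ℝ) 16, ← C.map_mul]; norm_num
      have e0 : L.sum = (C ((16 * M : ℕ) : ℝ)) * ys.sum + C (M : ℝ) * (C κ + distPoly u) := by
        simp [hL, Multiset.sum_nsmul, nsmul_eq_mul]
        rw [map_ofNat]; ring
      rw [e0, hsum, distPoly_zero, hN]
      push_cast
      simp only [C.map_add, C.map_mul, map_ofNat]
      linear_combination (C (M : ℝ) * (1 + spherePoly d - distPoly u)) * h16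
    rw [e1, hcard, mul_add, ← mul_assoc, ← C.map_mul, ← C.map_mul]
    congr 2
    · field_simp
    · congr 1; field_simp
  rw [hmean, hcard, hprod] at hamgm
  have h1 := hamgm.pExpLin_nonneg hS (by omega)
  have h2 := pExpLin_pow_add_spherePoly hμ hS (1 + κ * M / N) (M / N) (n := N) (by omega)
  rw [map_sub] at h1
  linarith

end Products

/-! ### The iteration -/

section Iteration

variable {d : ℕ}

/-- The state of the procedure after `r` rounds, in each of which the current pseudo-distribution
was reweighted by the `16M`-th power of a tilt; `ys` collects the tilts used so far. -/
structure TiltedRun (z k : ℕ) (δ η : ℝ) (μ : Vec d →₀ ℝ) (M r : ℕ) (u : Vec d)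
    (ys : Multiset (MvPolynomial (Fin d) ℝ)) : Prop where
  run : ReweightRun z k δ η μ r (16 * M * r) (reweight μ (ys.prod ^ (16 * M))) u
  card : ys.card = r
  cone : ∀ y ∈ ys, SphereCone 2 y
  degree : ys.prod.totalDegree ≤ r
  sum : ys.sum = C (r : ℝ) + C (1 / 16) * (distPoly 0 - distPoly u)
  mass : Real.exp z ^ r ≤ pExpLin μ (ys.prod ^ (16 * M))
  coord : ∀ i, |u i| ≤ 1
  supp : ∃ S : Finset (Fin d), S.card ≤ r ∧ ∀ i, i ∉ S → u i = 0

namespace TiltedRun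

variable {z k : ℕ} {δ η : ℝ} {μ : Vec d →₀ ℝ} {M r t : ℕ} {u : Vec d}
  {ys : Multiset (MvPolynomial (Fin d) ℝ)}

lemma init (hμ : IsPseudoDist t μ) : TiltedRun z k δ η μ M 0 0 0 where
  run := by simpa [reweight_one hμ] using ReweightRun.init
  card := rfl
  cone := by simp
  degree := by simp
  sum := by simp
  mass := by simp [hμ.pExpLin_one]
  coord := by simp
  supp := ⟨∅, by simp⟩

lemma isSumSq (_ : TiltedRun z k δ η μ M r u ys) : IsSumSq (ys.prod ^ (16 * M)) :=
  isSumSq_even_pow _ ⟨8 * M, by ring⟩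

lemma totalDegree_le (h : TiltedRun z k δ η μ M r u ys) :
    (ys.prod ^ (16 * M)).totalDegree ≤ 16 * M * r :=
  (totalDegree_pow _ _).trans (Nat.mul_le_mul_left _ h.degree)

lemma one_le_mass (h : TiltedRun z k δ η μ M r u ys) :
    1 ≤ pExpLin μ (ys.prod ^ (16 * M)) :=
  (one_le_pow₀ (Real.one_le_exp (by positivity))).trans h.mass

lemma mass_pos (h : TiltedRun z k δ η μ M r u ys) : 0 < pExpLin μ (ys.prod ^ (16 * M)) :=
  zero_lt_one.trans_le h.one_le_mass

lemma isReweighting (h : TiltedRun z k δ η μ M r u ys) :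
    IsReweighting (16 * M * r) μ (reweight μ (ys.prod ^ (16 * M))) :=
  isReweighting_reweight h.isSumSq h.totalDegree_le h.mass_pos

lemma satisfies (h : TiltedRun z k δ η μ M r u ys)
    (hS : Satisfies t μ (sphereConstraint d)) (ht : 16 * M * r ≤ t) :
    Satisfies (t - 16 * M * r) (reweight μ (ys.prod ^ (16 * M))) (sphereConstraint d) :=
  hS.reweight h.isSumSq h.totalDegree_le ht h.mass_pos

lemma isPseudoDist (h : TiltedRun z k δ η μ M r u ys)
    (hS : Satisfies t μ (sphereConstraint d)) (ht : 16 * M * r ≤ t) :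
    IsPseudoDist (t - 16 * M * r) (reweight μ (ys.prod ^ (16 * M))) :=
  IsPseudoDist.reweight hS h.isSumSq h.totalDegree_le ht h.mass_pos

lemma pExpLin_prod_mul_le (h : TiltedRun z k δ η μ M r u ys) (hμ : IsPseudoDist t μ)
    (hS : Satisfies t μ (sphereConstraint d)) (hM : 1 ≤ M) {κ : ℝ} (hκ : 0 ≤ κ)
    (ht : 2 * (2 * (16 * M * r + M)) + 2 ≤ t) :
    pExpLin μ (ys.prod ^ (16 * M) * (C κ + distPoly u) ^ M) ≤
      (1 + κ * M / (16 * M * r + M : ℕ)) ^ (16 * M * r + M) := by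
  obtain rfl := h.card
  exact _root_.pExpLin_prod_mul_le hμ hS hM h.cone h.sum hκ ht

/-- The number of rounds is at most `M / z`. -/
lemma mul_rounds_le (h : TiltedRun z k δ η μ M r u ys) (hμ : IsPseudoDist t μ)
    (hS : Satisfies t μ (sphereConstraint d)) (hM : 1 ≤ M)
    (ht : 2 * (2 * (16 * M * r + M)) + 2 ≤ t) : z * r ≤ M := by
  have h1 := h.pExpLin_prod_mul_le hμ hS hM zero_le_one ht
  have hM0 : (0 : ℝ) < M := by exact_mod_cast hM
  -- dropping the factor `(1 + ‖v - u‖²) ^ M` only decreases the pseudo-expectation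
  have h2 : pExpLin μ (ys.prod ^ (16 * M)) ≤
      pExpLin μ (ys.prod ^ (16 * M) * (C 1 + distPoly u) ^ M) := by
    have hcone : SphereCone (2 * M) ((C 1 + distPoly u) ^ M - 1) := by
      clear h1 hM hM0 ht h
      induction M with
      | zero => simpa using SphereCone.zero 0
      | succ M ih =>
        have e : (C 1 + distPoly u) ^ (M + 1) - 1 =
            ((C 1 + distPoly u) ^ M - 1) + (C 1 + distPoly u) ^ M * distPoly u := by
          rw [C.map_one]; ring
        rw [e]
        exact (ih.mono (by omega)).add
          (((((SphereCone.C_nonneg zero_le_one 2).add (sphereCone_distPoly u)).pow M).mul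
            (sphereCone_distPoly u)).mono (by ring_nf; omega))
    have h3 := ((SphereCone.of_isSumSq h.isSumSq h.totalDegree_le).mul hcone).pExpLin_nonneg
      hS (by omega)
    rw [mul_sub, mul_one, map_sub] at h3
    linarith
  have h4 : (1 + 1 * M / (16 * M * r + M : ℕ) : ℝ) ^ (16 * M * r + M) ≤ Real.exp M := by
    have hN : (0 : ℝ) < ((16 * M * r + M : ℕ) : ℝ) := by exact_mod_cast (by omega)
    calc (1 + 1 * M / (16 * M * r + M : ℕ) : ℝ) ^ (16 * M * r + M)
        ≤ Real.exp (M / (16 * M * r + M : ℕ)) ^ (16 * M * r + M) := by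
          rw [one_mul, add_comm]
          exact pow_le_pow_left₀ (by positivity) (Real.add_one_le_exp _) _
      _ = Real.exp M := by
          rw [← Real.exp_nat_mul]; congr 1; field_simp
  have h5 := (h.mass.trans (h2.trans h1)).trans h4
  rw [← Real.exp_nat_mul, Real.exp_le_exp] at h5
  have h6 : r * z ≤ M := by exact_mod_cast h5
  linarith

/-- The `M`-th pseudo-moment of `‖v - u‖²` never exceeds `1`. -/
lemma normMoment_le_one (h : TiltedRun z k δ η μ M r u ys) (hμ : IsPseudoDist t μ)
    (hS : Satisfies t μ (sphereConstraint d)) (hM : 1 ≤ M)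
    (ht : 2 * (2 * (16 * M * r + M)) + 2 ≤ t) :
    normMoment (reweight μ (ys.prod ^ (16 * M))) u M ≤ 1 := by
  have h1 := h.pExpLin_prod_mul_le hμ hS hM le_rfl ht
  rw [C.map_zero, zero_add, zero_mul, zero_div, add_zero, one_pow] at h1
  rw [normMoment_eq, pExpLin_reweight, div_le_one h.mass_pos]
  exact h1.trans h.one_le_mass

/-- While the moments of the distance are not all small, the threshold in the selection of the
coordinate is at least `τ ^ z` with `τ = η δ ^ (2k)`. -/
lemma le_normMoment (h : TiltedRun z k δ η μ M r u ys) (hμ : IsPseudoDist t μ)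
    (hS : Satisfies t μ (sphereConstraint d)) (hz : 1 ≤ z) (hzM : z ≤ M)
    (hδ0 : 0 < δ) (hδ : δ < 1 / 2) (hη0 : 0 < η) (hη1 : η < 1) (hkM : k + 1 / η ≤ M)
    (ht : 200 * M * (r + 1) ≤ t)
    (hsmall : ¬ SmallMoments k η (reweight μ (ys.prod ^ (16 * M))) u) :
    (η * δ ^ (2 * k)) ^ z ≤
      δ ^ (2 * z) * normMoment (reweight μ (ys.prod ^ (16 * M))) u z := by
  have ht' : 200 * (M * r) + 200 * M ≤ t := by linarith
  have e16 : 16 * M * r = 16 * (M * r) := by ring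
  have hS' := h.satisfies hS (by omega)
  have hμ' := h.isPseudoDist hS (by omega)
  rw [SmallMoments] at hsmall
  push Not at hsmall
  obtain ⟨y, hy, hmy⟩ := hsmall
  rw [Finset.mem_Icc] at hy
  exact moment_lower_bound (K := M) (fun b hb => normMoment_nonneg hS' u (by omega))
    (fun b hb => normMoment_sq_le hS' u (by omega)) (normMoment_zero hμ' u)
    (h.normMoment_le_one hμ hS (hz.trans hzM) (by omega)) hδ0 hδ hη0 hη1 hz hy.1 hy.2 hzM hkM hmy

lemma distPoly_add_single (u : Vec d) (i : Fin d) (c : ℝ) :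
    distPoly (u + EuclideanSpace.single i c) =
      distPoly u - (X i - C (u i)) ^ 2 + (X i - C (u i + c)) ^ 2 := by
  rw [distPoly, distPoly, ← Finset.sum_erase_add _ _ (Finset.mem_univ i),
    ← Finset.sum_erase_add Finset.univ _ (Finset.mem_univ i)]
  have e1 : ∀ j ∈ Finset.univ.erase i,
      (X j - C ((u + EuclideanSpace.single i c) j) : MvPolynomial (Fin d) ℝ) ^ 2 =
        (X j - C (u j)) ^ 2 := by
    intro j hj
    simp [Finset.ne_of_mem_erase hj]
  rw [Finset.sum_congr rfl e1]
  simp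

/-- One more round can be made from any state in which neither stopping criterion holds. -/
lemma step (h : TiltedRun z k δ η μ M r u ys) (hd : 0 < d) (hμ : IsPseudoDist t μ)
    (hS : Satisfies t μ (sphereConstraint d)) (hz : 1 ≤ z) (hlog : Real.log d ≤ z)
    (hδ0 : 0 < δ) (hδ : δ < 1 / 2) (hη0 : 0 < η) (hη1 : η < 1)
    (hM : 64 * z ≤ M * (η * δ ^ (2 * k))) (hkM : k + 1 / η ≤ M)
    (ht : 200 * M * (r + 1) ≤ t)
    (hsmall : ¬ SmallMoments k η (reweight μ (ys.prod ^ (16 * M))) u)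
    (hdense : ¬ AnalyticallyDense z δ (reweight μ (ys.prod ^ (16 * M))) u) :
    ∃ u' ys', TiltedRun z k δ η μ M (r + 1) u' ys' := by
  have ht' : 200 * (M * r) + 200 * M ≤ t := by linarith
  have e16 : 16 * M * r = 16 * (M * r) := by ring
  have hS' := h.satisfies hS (by omega)
  have hμ' := h.isPseudoDist hS (by omega)
  have hτ0 : 0 < η * δ ^ (2 * k) := by positivity
  have hτ1 : η * δ ^ (2 * k) ≤ 1 :=
    mul_le_one₀ hη1.le (by positivity) (pow_le_one₀ hδ0.le (by linarith))
  have hzM : z ≤ M := by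
    have : 64 * (z : ℝ) ≤ M := hM.trans (mul_le_of_le_one_right (by positivity) hτ1)
    have : 64 * z ≤ M := by exact_mod_cast this
    omega
  have hlow := h.le_normMoment hμ hS hz hzM hδ0 hδ hη0 hη1 hkM ht hsmall
  obtain ⟨i, hi⟩ := exists_large_coord hd hS' (by omega) hlog hδ0 hdense
  have hmom := hlow.trans hi.le
  rw [pExp_coord_pow_eq] at hmom
  obtain ⟨a, ha, hexp, hstat⟩ := exists_tilt hS' i (h.coord i) hz hτ0 hτ1 hM hmom (by omega)
  set ν := reweight μ (ys.prod ^ (16 * M)) with hν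
  set y := tiltPoly i (u i) a with hy
  have hpos : 0 < pExpLin ν (y ^ (16 * M)) := (Real.exp_pos _).trans_le hexp
  have hrew : reweight ν (y ^ (16 * M)) = reweight μ ((y ::ₘ ys).prod ^ (16 * M)) := by
    rw [hν, reweight_reweight μ h.mass_pos.ne', Multiset.prod_cons, mul_pow, mul_comm]
  have hshift : pExp (reweight ν (y ^ (16 * M))) (fun v => v i - u i) = a - u i := by
    have e1 : pExp (reweight ν (y ^ (16 * M))) (fun v => v i - u i) =
        pExpLin (reweight ν (y ^ (16 * M))) (X i - C (u i)) :=
      pExpLin_eq_of_eval _ fun v => by simp [polyFun]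
    rw [e1, pExpLin_reweight, mul_sub, map_sub, hstat, mul_comm _ (C (u i)), pExpLin_C_mul]
    field_simp
  refine ⟨u + EuclideanSpace.single i (a - u i), y ::ₘ ys, ?_, ?_, ?_, ?_, ?_, ?_, ?_, ?_⟩
  · have := ReweightRun.round i h.run hsmall hdense hi
      (isReweighting_reweight (isSumSq_tiltPoly_pow i (u i) a M)
        (totalDegree_tiltPoly_pow_le i (u i) a (16 * M)) hpos)
    rw [hshift, hrew] at this
    rwa [show 16 * M * (r + 1) = 16 * M * r + 16 * M by ring]
  · rw [Multiset.card_cons, h.card]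
  · intro f hf
    rcases Multiset.mem_cons.1 hf with rfl | hf
    · exact sphereCone_tiltPoly i (h.coord i) (ha.trans (by norm_num))
    · exact h.cone f hf
  · rw [Multiset.prod_cons, add_comm]
    exact (totalDegree_mul _ _).trans (add_le_add (totalDegree_tiltPoly_le i (u i) a) h.degree)
  · rw [Multiset.sum_cons, h.sum, distPoly_add_single, hy, tiltPoly]
    have e1 : u i + (a - u i) = a := by ring
    have e2 : (a - u i) / 8 = 1 / 16 * 2 * (a - u i) := by ring
    have e3 : 1 - (a ^ 2 - u i ^ 2) / 16 = 1 - 1 / 16 * (a ^ 2 - u i ^ 2) := by ring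
    rw [e1, e2, e3]
    simp only [C.map_add, C.map_mul, C.map_pow, map_sub, C.map_one, map_ofNat, Nat.cast_succ]
    ring
  · have e1 : pExpLin μ ((y ::ₘ ys).prod ^ (16 * M)) =
        pExpLin ν (y ^ (16 * M)) * pExpLin μ (ys.prod ^ (16 * M)) := by
      rw [hν, pExpLin_reweight, div_mul_cancel₀ _ h.mass_pos.ne', Multiset.prod_cons, mul_pow,
        mul_comm]
    rw [e1, pow_succ']
    exact mul_le_mul hexp h.mass (by positivity) hpos.le
  · intro j
    rcases eq_or_ne j i with rfl | hj
    · simpa using ha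
    · simpa [hj] using h.coord j
  · obtain ⟨S, hScard, hS0⟩ := h.supp
    refine ⟨insert i S, (Finset.card_insert_le _ _).trans (by omega), fun j hj => ?_⟩
    rw [Finset.mem_insert, not_or] at hj
    simp [hj.1, hS0 j hj.2]

end TiltedRun

lemma exists_tiltedRun {z k : ℕ} {δ η : ℝ} {μ : Vec d →₀ ℝ} {M t : ℕ} (hd : 0 < d)
    (hμ : IsPseudoDist t μ)
    (hS : Satisfies t μ (sphereConstraint d)) (hz : 1 ≤ z) (hlog : Real.log d ≤ z)
    (hδ0 : 0 < δ) (hδ : δ < 1 / 2) (hη0 : 0 < η) (hη1 : η < 1)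
    (hM : 64 * z ≤ M * (η * δ ^ (2 * k))) (hkM : k + 1 / η ≤ M) (r : ℕ)
    (ht : 200 * M * (r + 1) ≤ t) :
    (∃ r' u ys, r' ≤ r ∧ TiltedRun z k δ η μ M r' u ys ∧
      (SmallMoments k η (reweight μ (ys.prod ^ (16 * M))) u ∨
        AnalyticallyDense z δ (reweight μ (ys.prod ^ (16 * M))) u)) ∨
      ∃ u ys, TiltedRun z k δ η μ M r u ys := by
  induction r with
  | zero => exact Or.inr ⟨0, 0, TiltedRun.init hμ⟩
  | succ r ih =>
    have ht' : 200 * M * (r + 1) ≤ t := le_trans (Nat.mul_le_mul_left _ (by omega)) ht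
    rcases ih ht' with ⟨r', u, ys, hr', h⟩ | ⟨u, ys, h⟩
    · exact Or.inl ⟨r', u, ys, by omega, h⟩
    · by_cases hend : SmallMoments k η (reweight μ (ys.prod ^ (16 * M))) u ∨
        AnalyticallyDense z δ (reweight μ (ys.prod ^ (16 * M))) u
      · exact Or.inl ⟨r, u, ys, by omega, h, hend⟩
      · rw [not_or] at hend
        exact Or.inr (h.step hd hμ hS hz hlog hδ0 hδ hη0 hη1 hM hkM ht' hend.1 hend.2)

/-- The procedure stops within `M / z` rounds: the state at round `M / z + 1` would contradict
`TiltedRun.mul_rounds_le`. -/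
lemma exists_stopped_tiltedRun {z k : ℕ} {δ η : ℝ} {μ : Vec d →₀ ℝ} {M t : ℕ} (hd : 0 < d)
    (hμ : IsPseudoDist t μ)
    (hS : Satisfies t μ (sphereConstraint d)) (hz : 1 ≤ z) (hlog : Real.log d ≤ z)
    (hδ0 : 0 < δ) (hδ : δ < 1 / 2) (hη0 : 0 < η) (hη1 : η < 1)
    (hM : 64 * z ≤ M * (η * δ ^ (2 * k))) (hkM : k + 1 / η ≤ M)
    (ht : 200 * M * (M / z + 2) ≤ t) :
    ∃ r u ys, z * r ≤ M ∧ TiltedRun z k δ η μ M r u ys ∧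
      (SmallMoments k η (reweight μ (ys.prod ^ (16 * M))) u ∨
        AnalyticallyDense z δ (reweight μ (ys.prod ^ (16 * M))) u) := by
  have hM1 : 1 ≤ M := by
    rcases Nat.eq_zero_or_pos M with rfl | h
    · have : 0 < 1 / η := by positivity
      have : (0 : ℝ) ≤ k := by positivity
      simp only [Nat.cast_zero] at hkM
      linarith
    · exact h
  have hbound : ∀ r ≤ M / z + 1, ∀ u ys, TiltedRun z k δ η μ M r u ys → z * r ≤ M := by
    intro r hr u ys h
    refine h.mul_rounds_le hμ hS hM1 ?_
    have h1 : 16 * M * r ≤ 16 * M * (M / z + 1) := Nat.mul_le_mul_left _ hr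
    have h2 : 200 * (M * (M / z)) + 400 * M ≤ t := by linarith
    have h3 : 16 * M * (M / z + 1) = 16 * (M * (M / z)) + 16 * M := by ring
    omega
  rcases exists_tiltedRun hd hμ hS hz hlog hδ0 hδ hη0 hη1 hM hkM (M / z + 1) ht with
    ⟨r, u, ys, hr, h, hend⟩ | ⟨u, ys, h⟩
  · exact ⟨r, u, ys, hbound r hr u ys h, h, hend⟩
  · have h1 := hbound _ le_rfl u ys h
    have h2 := Nat.lt_mul_div_succ M (show 0 < z by omega)
    omega

end Iteration

theorem theorem5p1 :
    ∃ C : ℝ, 0 < C ∧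
      ∀ (k d z t : ℕ) (δ η : ℝ), 0 < d → 0 < δ → δ < 1 → 0 < η → η < 1 →
        Real.log d ≤ z →
        C * (z / (η ^ 2 * δ ^ (4 * k + 2))) ≤ t →
        ∀ μ : Vec d →₀ ℝ, IsPseudoDist t μ → Satisfies t μ (sphereConstraint d) →
          ∃ (n s : ℕ) (μ' : Vec d →₀ ℝ) (u : Vec d) (S : Finset (Fin d)),
            -- the pair `(μ', u)` is an output of the iterative reweighting procedure
            ReweightRun z k δ η μ n s μ' u ∧
            (n : ℝ) ≤ C / (δ ^ (4 * k + 2) * η ^ 2) ∧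
            -- `μ'` is a reweighting of `μ` and a pseudo-distribution of degree at least `t / 2`
            2 * s ≤ t ∧
            IsReweighting s μ μ' ∧
            IsPseudoDist (t - s) μ' ∧
            Satisfies (t - s) μ' (sphereConstraint d) ∧
            -- `u` is supported on few coordinates
            (S.card : ℝ) ≤ C / (δ ^ (4 * k + 2) * η ^ 2) ∧
            (∀ i, i ∉ S → u i = 0) ∧
            -- the two cases
            ((AnalyticallyDense z δ μ' u ∧ ∃ y ∈ Finset.Icc 1 k, η < normMoment μ' u y) ∨
              SmallMoments k η μ' u) := by
  -- the degree needed is `200 M (M / z + 2) ≤ 200 * 65 * 67 * z / τ²` with `τ = η δ ^ (2k)`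
  refine ⟨1000000, by norm_num, ?_⟩
  intro k d z t δ η hd hδ0 hδ1 hη0 hη1 hlog ht μ hμ hS
  have hE0 : 0 < η ^ 2 * δ ^ (4 * k + 2) := by positivity
  -- a stopped run whose number of rounds and total degree are small gives the conclusion
  have finish : ∀ (M r : ℕ) (u : Vec d) (ys : Multiset (MvPolynomial (Fin d) ℝ)),
      TiltedRun z k δ η μ M r u ys → 2 * (16 * M * r) ≤ t →
      (r : ℝ) ≤ 1000000 / (δ ^ (4 * k + 2) * η ^ 2) →
      (SmallMoments k η (reweight μ (ys.prod ^ (16 * M))) u ∨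
        AnalyticallyDense z δ (reweight μ (ys.prod ^ (16 * M))) u) →
      ∃ (n s : ℕ) (μ' : Vec d →₀ ℝ) (u : Vec d) (S : Finset (Fin d)),
        ReweightRun z k δ η μ n s μ' u ∧ (n : ℝ) ≤ 1000000 / (δ ^ (4 * k + 2) * η ^ 2) ∧
        2 * s ≤ t ∧ IsReweighting s μ μ' ∧ IsPseudoDist (t - s) μ' ∧
        Satisfies (t - s) μ' (sphereConstraint d) ∧
        (S.card : ℝ) ≤ 1000000 / (δ ^ (4 * k + 2) * η ^ 2) ∧ (∀ i, i ∉ S → u i = 0) ∧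
        ((AnalyticallyDense z δ μ' u ∧ ∃ y ∈ Finset.Icc 1 k, η < normMoment μ' u y) ∨
          SmallMoments k η μ' u) := by
    intro M r u ys h hs hr hend
    obtain ⟨S, hScard, hS0⟩ := h.supp
    refine ⟨r, 16 * M * r, reweight μ (ys.prod ^ (16 * M)), u, S, h.run, hr, hs,
      h.isReweighting, h.isPseudoDist hS (by omega), h.satisfies hS (by omega),
      le_trans (by exact_mod_cast hScard) hr, hS0, ?_⟩
    by_cases hsm : SmallMoments k η (reweight μ (ys.prod ^ (16 * M))) u
    · exact Or.inr hsm
    · refine Or.inl ⟨hend.resolve_left hsm, ?_⟩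
      rw [SmallMoments] at hsm
      push Not at hsm
      exact hsm
  have finish0 : (SmallMoments k η μ 0 ∨ AnalyticallyDense z δ μ 0) → _ := fun hend =>
    finish 0 0 0 0 (TiltedRun.init hμ) (by simp)
      (by rw [Nat.cast_zero]; positivity) (by simpa [reweight_one hμ] using hend)
  rcases Nat.eq_zero_or_pos k with rfl | hk
  · exact finish0 (Or.inl fun y hy => by simp at hy)
  rcases Nat.eq_zero_or_pos z with rfl | hz
  · -- here `log d ≤ 0`, so `d = 1` and both sides of the density condition equal `1`
    have hd1 : d = 1 := by
      by_contra hne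
      have h1 : (1 : ℝ) < d := by exact_mod_cast (by omega : 1 < d)
      have h2 := Real.log_pos h1
      simp only [Nat.cast_zero] at hlog
      linarith
    refine finish0 (Or.inr ?_)
    rw [AnalyticallyDense, normMoment_zero hμ]
    subst hd1
    simpa using hμ.total_mass.le
  have hz0 : (1 : ℝ) ≤ z := by exact_mod_cast hz
  have hE1 : η ^ 2 * δ ^ (4 * k + 2) ≤ (η * δ ^ (2 * k)) ^ 2 := by
    rw [mul_pow, ← pow_mul]
    have : δ ^ (4 * k + 2) ≤ δ ^ (2 * k * 2) :=
      pow_le_pow_of_le_one hδ0.le hδ1.le (by omega)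
    gcongr
  set τ := η * δ ^ (2 * k) with hτ
  have hτ0 : 0 < τ := by positivity
  have hτ1 : τ ≤ 1 := mul_le_one₀ hη1.le (by positivity) (pow_le_one₀ hδ0.le hδ1.le)
  have hτ2 : τ ^ 2 ≤ 1 := pow_le_one₀ hτ0.le hτ1
  have ht2 : 1000000 * (z / τ ^ 2) ≤ (t : ℝ) := by
    refine le_trans ?_ ht
    gcongr
  rcases le_or_gt (1 / 2) δ with hδ | hδ
  · refine finish0 (Or.inr (analyticallyDense_of_half_le hS hz ?_ hδ 0))
    have h1 : (z : ℝ) ≤ z / τ ^ 2 := by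
      rw [le_div_iff₀ (by positivity)]
      exact mul_le_of_le_one_right (by positivity) hτ2
    have : (2 * z : ℝ) ≤ t := by linarith
    exact_mod_cast this
  -- the main case
  set M := ⌈64 * z / τ⌉₊ with hMdef
  have hMge : 64 * z / τ ≤ M := Nat.le_ceil _
  have hzτ : 1 ≤ z / τ := by rw [le_div_iff₀ hτ0]; linarith
  have hMle : (M : ℝ) ≤ 65 * (z / τ) := by
    have := (Nat.ceil_lt_add_one (by positivity : 0 ≤ 64 * z / τ)).le
    rw [← hMdef, mul_div_assoc] at this
    linarith
  have hM : 64 * z ≤ M * τ := by rwa [div_le_iff₀ hτ0] at hMge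
  have hkM : k + 1 / η ≤ M := by
    have h1 : ((k : ℝ) + 1) * δ ^ (2 * k) ≤ 1 := by
      have h2 : ((k : ℝ) + 1) ≤ 4 ^ k := by
        exact_mod_cast Nat.succ_le_of_lt (Nat.lt_pow_self (by norm_num))
      have h3 : δ ^ (2 * k) ≤ (1 / 4) ^ k := by
        rw [pow_mul]
        exact pow_le_pow_left₀ (by positivity) (by nlinarith) k
      calc ((k : ℝ) + 1) * δ ^ (2 * k) ≤ 4 ^ k * (1 / 4) ^ k := by gcongr
        _ = 1 := by rw [← mul_pow]; norm_num
    have h4 : k + 1 / η ≤ (k + 1) / η := by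
      rw [add_div]
      gcongr
      rw [le_div_iff₀ hη0]
      exact mul_le_of_le_one_right (by positivity) hη1.le
    have h5 : (k + 1) / η ≤ 64 * z / τ := by
      rw [div_le_div_iff₀ hη0 hτ0, hτ]
      calc ((k : ℝ) + 1) * (η * δ ^ (2 * k)) = ((k + 1) * δ ^ (2 * k)) * η := by ring
        _ ≤ 1 * η := by gcongr
        _ ≤ 64 * z * η := by gcongr; linarith
    exact h4.trans (h5.trans hMge)
  have hdiv : ((M / z : ℕ) : ℝ) + 2 ≤ 67 / τ := by
    have h1 : ((M / z : ℕ) : ℝ) ≤ M / z := Nat.cast_div_le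
    have h2 : (M : ℝ) / z ≤ 65 / τ := by
      rw [div_le_iff₀ (by linarith)]
      exact hMle.trans (le_of_eq (by ring))
    have h3 : 1 ≤ 1 / τ := by rw [le_div_iff₀ hτ0]; linarith
    have h4 : 67 / τ = 65 / τ + 2 * (1 / τ) := by ring
    linarith
  have ht3 : 200 * M * (M / z + 2) ≤ t := by
    have h1 : (200 * M * ((M / z : ℕ) + 2) : ℝ) ≤ t := by
      calc (200 * M * ((M / z : ℕ) + 2) : ℝ) ≤ 200 * (65 * (z / τ)) * (67 / τ) := by gcongr
        _ = 871000 * (z / τ ^ 2) := by field_simp; norm_num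
        _ ≤ 1000000 * (z / τ ^ 2) := by gcongr; norm_num
        _ ≤ t := ht2
    exact_mod_cast h1
  obtain ⟨r, u, ys, hr, h, hend⟩ :=
    exists_stopped_tiltedRun hd hμ hS hz hlog hδ0 hδ hη0 hη1 hM hkM ht3
  have hrdiv : r ≤ M / z := (Nat.le_div_iff_mul_le hz).2 (by rwa [mul_comm])
  refine finish M r u ys h ?_ ?_ hend
  · have h1 : 16 * M * r ≤ 16 * M * (M / z) := Nat.mul_le_mul_left _ hrdiv
    have h2 : 200 * (M * (M / z)) + 400 * M ≤ t := by linarith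
    have h3 : 16 * M * (M / z) = 16 * (M * (M / z)) := by ring
    omega
  · have h1 : (r : ℝ) ≤ (M / z : ℕ) := by exact_mod_cast hrdiv
    have h2 : 1 / τ ≤ 1 / (δ ^ (4 * k + 2) * η ^ 2) := by
      refine one_div_le_one_div_of_le (by positivity) ?_
      rw [mul_comm]
      exact hE1.trans (by rw [sq]; exact mul_le_of_le_one_right hτ0.le hτ1)
    have h3 : 67 / τ = 67 * (1 / τ) := by ring
    have h4 : 1000000 / (δ ^ (4 * k + 2) * η ^ 2) =
        1000000 * (1 / (δ ^ (4 * k + 2) * η ^ 2)) := by ring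
    have h5 : 0 < 1 / τ := by positivity
    linarith
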